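/- Let $0<a\le b$ and $c_0>0$ be constants. There is a constant $C>0$, depending only on $a,b,c_0$, such that the following holds for all integers $d_1\ge 2$ and $n\ge c_0\,d_1\log d_1$ and all real $M$ and $\eta_1>0$. Let $X_1,\dots,X_n$ be i.i.d. random vectors in $\mathbb{R}^{d_1}$ with $\mathbb{E}[X_i]=0$ and $\sup_{\|u\|_2=1}\mathbb{E}[(X_i^\top u)^4]\le M<\infty$, and put $\Sigma_{XX}=\mathbb{E}[X_iX_i^\top]$. Let $\Lambda_1,\dots,\Lambda_n$ be i.i.d. dithers, each distributed as the sum of two independent uniform random vectors on $[-\eta_1/2,\eta_1/2]^{d_1}$, such that $X_1,\dots,X_n,\Lambda_1,\dots,\Lambda_n$ are mutually independent. Let $$a\Big(\frac{n d_1 M}{\log d_1}\Big)^{1/4}\le\tau\le b\Big(\frac{n d_1 M}{\log d_1}\Big)^{1/4},\qquad \widehat X_i=\frac{\min(\|X_i\|_2,\tau)}{\|X_i\|_2}X_i\quad(\widehat X_i=0\text{ if }X_i=0),$$ $$Q_{\eta_1}(x)=\eta_1\Big(\Big\lfloor\frac{x}{\eta_1}\Big\rfloor+\frac12\Big),\qquad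 \widetilde X_i=Q_{\eta_1}(\widehat X_i+\Lambda_i)\ \text{(coordinatewise)},\qquad \widetilde\Sigma_{XX}=\frac1n\sum_{i=1}^n\widetilde X_i\widetilde X_i^\top-\frac{\eta_1^2}{4}I_{d_1}.$$ Then for every $\delta>2$, $$\mathbb{P}\left(\big\|\widetilde\Sigma_{XX}-\Sigma_{XX}\big\|_{\mathrm{op}}\le C\,\delta\,\big(M^{1/2}+\eta_1^2\big)\sqrt{\frac{d_1\log d_1}{n}}\right)\ge 1-2\big(d_1^{1-\delta}+d_1^{2-\delta}\big).$$ -/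

import Mathlib

open MeasureTheory ProbabilityTheory
open scoped RealInnerProductSpace

noncomputable section

/-- Shrinkage of a vector to Euclidean norm level `τ`: `((‖x‖ ∧ τ) / ‖x‖) x`
(which is `0` for `x = 0`). -/
def shrink {d : ℕ} (τ : ℝ) (x : EuclideanSpace ℝ (Fin d)) : EuclideanSpace ℝ (Fin d) :=
  (min ‖x‖ τ / ‖x‖) • x

/-- The uniform scalar quantizer `Q_η(t) = η (⌊t / η⌋ + 1 / 2)`. -/
def quantize (η t : ℝ) : ℝ :=
  η * ((⌊t / η⌋ : ℝ) + 1 / 2)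

/-- The quantizer applied to every coordinate of a vector. -/
def quantizeVec {d : ℕ} (η : ℝ) (x : EuclideanSpace ℝ (Fin d)) : EuclideanSpace ℝ (Fin d) :=
  WithLp.toLp 2 fun j => quantize η (x j)

/-- The cube `[-η/2, η/2]^d`. -/
def cube (d : ℕ) (η : ℝ) : Set (EuclideanSpace ℝ (Fin d)) :=
  {x | ∀ j, x j ∈ Set.Icc (-(η / 2)) (η / 2)}

/-- The uniform distribution on the cube `[-η/2, η/2]^d`: Lebesgue measure conditioned on it. -/
def uniformCube (d : ℕ) (η : ℝ) : Measure (EuclideanSpace ℝ (Fin d)) :=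
  cond volume (cube d η)

/-- The law of the dither: the law of the sum of two independent vectors, each uniformly
distributed on `[-η/2, η/2]^d`. -/
def ditherLaw (d : ℕ) (η : ℝ) : Measure (EuclideanSpace ℝ (Fin d)) :=
  (uniformCube d η).conv (uniformCube d η)

/-- The truncated, dithered and quantized sample point `Q_η(x̂ + l)`, for a data point `x` and a
dither `l`. -/
def quantizedSample {d : ℕ} (τ η : ℝ) (x l : EuclideanSpace ℝ (Fin d)) :
    EuclideanSpace ℝ (Fin d) :=
  quantizeVec η (shrink τ x + l)

/-- The corrected covariance estimator `(1/n) ∑ᵢ x̃ᵢ x̃ᵢᵀ - (η²/4) I` computed from the data points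
`x` and the dithers `l`. -/
def covEstimator {n d : ℕ} (τ η : ℝ) (x l : Fin n → EuclideanSpace ℝ (Fin d)) :
    Matrix (Fin d) (Fin d) ℝ :=
  (1 / (n : ℝ)) • ∑ i, Matrix.vecMulVec (quantizedSample τ η (x i) (l i)).ofLp
      (quantizedSample τ η (x i) (l i)).ofLp
    - (η ^ 2 / 4) • (1 : Matrix (Fin d) (Fin d) ℝ)

/-- The matrix `𝔼[X Xᵀ]` for a random vector `X` with law `ν`. -/
def secondMoment {d : ℕ} (ν : Measure (EuclideanSpace ℝ (Fin d))) :
    Matrix (Fin d) (Fin d) ℝ :=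
  Matrix.of fun j k => ∫ x, x j * x k ∂ν

/-- The spectral norm of a real square matrix: its operator norm on Euclidean space. -/
def opNorm {d : ℕ} (A : Matrix (Fin d) (Fin d) ℝ) : ℝ :=
  ‖Matrix.toEuclideanCLM (n := Fin d) (𝕜 := ℝ) A‖

end

/-! The error splits into the fluctuation of the quantized outer products around their mean and the
bias due to shrinkage. Quantization adds no further bias: the triangular dither gives the
quantization error mean zero and variance exactly `η²/4` in each coordinate for every input,
independently over coordinates, so the mean of an outer product is that of the shrunken data plus
`η²/4 · I` (`integral_vecMulVec_quantizedSample`).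

In a unit direction the bias is at most `τ⁻² 𝔼 ‖X‖² ⟪X, u⟫² ≤ d M / τ²`
(`norm_secondMoment_sub_shrink_le`). For the fluctuation, each outer product has norm of order `τ² +
d η²`, and its matrix variance is at most `8 d (M + 486 η⁴)`
(`posSemidef_sub_integral_centered_sq`): the accumulated quantization error along a unit vector is
sub-Gaussian at scale `η` whatever the dimension. Matrix Bernstein then applies. With `τ⁴` of order
`n d M / log d`, the bias and the truncation level balance at the rate `√(d log d / n)`; the lower
bound on `n` handles the part `d η²` of the norm bound.

Bernstein's inequality is proved by the Ahlswede-Winter argument, which peels off one summand at a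
time by Golden-Thompson. The latter comes from the Lie product formula and a Lieb-Thirring trace
inequality for exponents that are powers of two. -/

/-! ### Trace inequalities for matrix powers. -/

section TraceExponential

open Matrix Filter Topology
open scoped Matrix.Norms.L2Operator

variable {ι : Type*} [Fintype ι]

/-- The squared Frobenius norm of the antisymmetric difference `X - Xᴴ` is nonnegative. -/
theorem Matrix.trace_mul_self_le (X : Matrix ι ι ℝ) : (X * X).trace ≤ (X * Xᴴ).trace := by
  have h := (posSemidef_self_mul_conjTranspose (X - Xᴴ)).trace_nonneg
  have h1 : ((X - Xᴴ) * (X - Xᴴ)ᴴ).trace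
      = (X * Xᴴ).trace - (X * X).trace - (Xᴴ * Xᴴ).trace + (Xᴴ * X).trace := by
    simp only [conjTranspose_sub, conjTranspose_conjTranspose, sub_mul, mul_sub, trace_sub]
    ring
  have h2 : (Xᴴ * Xᴴ).trace = (X * X).trace := by
    rw [← conjTranspose_mul, trace_conjTranspose]; simp
  have h3 : (Xᴴ * X).trace = (X * Xᴴ).trace := trace_mul_comm _ _
  linarith

theorem Matrix.trace_mul_le_half {A B : Matrix ι ι ℝ} (hA : A.IsHermitian) (hB : B.IsHermitian) :
    2 * (A * B).trace ≤ (A * A).trace + (B * B).trace := by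
  have h := (posSemidef_self_mul_conjTranspose (A - B)).trace_nonneg
  have h1 : ((A - B) * (A - B)ᴴ).trace
      = (A * A).trace - (A * B).trace - (B * A).trace + (B * B).trace := by
    simp only [conjTranspose_sub, hA.eq, hB.eq, sub_mul, mul_sub, trace_sub]
    ring
  have h3 : (B * A).trace = (A * B).trace := trace_mul_comm _ _
  linarith

variable [DecidableEq ι]

theorem Matrix.trace_pow_mul_comm (A B : Matrix ι ι ℝ) (m : ℕ) :
    ((A * B) ^ m).trace = ((B * A) ^ m).trace := by
  cases m with
  | zero => simp
  | succ m =>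
    rw [pow_succ, ← mul_assoc, trace_mul_comm, ← mul_assoc, mul_assoc, mul_pow_mul, ← mul_assoc,
      pow_succ']

/-- Two trace inequalities for powers of two, proved by a joint induction: a Weyl type inequality
for `X ^ 2 ^ (k + 1)` and a Lieb-Thirring type inequality for `(H * K) ^ 2 ^ k`. -/
theorem Matrix.trace_two_pow_le (k : ℕ) :
    (∀ X : Matrix ι ι ℝ, (X ^ 2 ^ (k + 1)).trace ≤ ((X * Xᴴ) ^ 2 ^ k).trace) ∧
    (∀ H K : Matrix ι ι ℝ, H.IsHermitian → K.IsHermitian →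
      ((H * K) ^ 2 ^ k).trace ≤ (H ^ 2 ^ k * K ^ 2 ^ k).trace) := by
  induction k with
  | zero => exact ⟨fun X => by simpa [pow_two] using trace_mul_self_le X, fun H K _ _ => by simp⟩
  | succ k ih =>
    obtain ⟨ihS, ihT⟩ := ih
    refine ⟨fun X => ?_, fun H K hH hK => ?_⟩
    -- Apply the Weyl bound to `X * X`; cyclicity brings out the symmetric factors `Q = X * Xᴴ` and
    -- `P = Xᴴ * X`, which Lieb-Thirring separates. Equal power traces of `P` and `Q` let the
    -- arithmetic-geometric mean bound close the step.
    · have hP : (Xᴴ * X).IsHermitian := isHermitian_conjTranspose_mul_self X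
      have hQ : (X * Xᴴ).IsHermitian := isHermitian_mul_conjTranspose_self X
      calc (X ^ 2 ^ (k + 1 + 1)).trace = ((X * X) ^ 2 ^ (k + 1)).trace := by
            rw [← pow_two, ← pow_mul, ← pow_succ']
        _ ≤ ((X * X * (X * X)ᴴ) ^ 2 ^ k).trace := ihS _
        _ = ((X * (X * Xᴴ * Xᴴ)) ^ 2 ^ k).trace := by
            simp only [conjTranspose_mul, mul_assoc]
        _ = (((X * Xᴴ) * (Xᴴ * X)) ^ 2 ^ k).trace := by
            rw [trace_pow_mul_comm]; simp only [mul_assoc]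
        _ ≤ ((X * Xᴴ) ^ 2 ^ k * (Xᴴ * X) ^ 2 ^ k).trace := ihT _ _ hQ hP
        _ ≤ ((X * Xᴴ) ^ 2 ^ (k + 1)).trace := by
            have h := trace_mul_le_half (hQ.pow (2 ^ k)) (hP.pow (2 ^ k))
            simp only [← pow_add, ← two_mul, ← pow_succ'] at h
            rw [trace_pow_mul_comm Xᴴ X] at h
            linarith
    -- The Weyl bound for `H * K` and cyclicity lead to the product of the squares `H * H` and `K *
    -- K`, at half the exponent.
    · calc ((H * K) ^ 2 ^ (k + 1)).trace ≤ ((H * K * (H * K)ᴴ) ^ 2 ^ k).trace := ihS _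
        _ = ((H * (K * K * H)) ^ 2 ^ k).trace := by
            simp only [conjTranspose_mul, hH.eq, hK.eq, mul_assoc]
        _ = (((K * K) * (H * H)) ^ 2 ^ k).trace := by
            rw [trace_pow_mul_comm]; simp only [mul_assoc]
        _ = (((H * H) * (K * K)) ^ 2 ^ k).trace := trace_pow_mul_comm _ _ _
        _ ≤ ((H * H) ^ 2 ^ k * (K * K) ^ 2 ^ k).trace :=
            ihT _ _ (by simpa [pow_two] using hH.pow 2) (by simpa [pow_two] using hK.pow 2)
        _ = (H ^ 2 ^ (k + 1) * K ^ 2 ^ (k + 1)).trace := by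
            simp only [← pow_two, ← pow_mul, ← pow_succ']

end TraceExponential

/-! ### The Lie product formula. -/

section LieProduct
open Filter Topology NormedSpace

variable {𝔸 : Type*} [NormedRing 𝔸] [NormOneClass 𝔸]

/-- Telescoping: each of the `n + 1` terms has one factor `x - y` and `n` factors of norm at most
`r`. -/
theorem norm_pow_sub_pow_le {x y : 𝔸} {r : ℝ} (hr : 0 ≤ r) (hx : ‖x‖ ≤ r) (hy : ‖y‖ ≤ r) (n : ℕ) :
    ‖x ^ (n + 1) - y ^ (n + 1)‖ ≤ (n + 1) * r ^ n * ‖x - y‖ := by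
  induction n with
  | zero => simp
  | succ n ih =>
    have h : x ^ (n + 1 + 1) - y ^ (n + 1 + 1)
        = x ^ (n + 1) * (x - y) + (x ^ (n + 1) - y ^ (n + 1)) * y := by
      rw [pow_succ x (n + 1), pow_succ y (n + 1)]; noncomm_ring
    rw [h]
    have h1 : ‖x ^ (n + 1) * (x - y)‖ ≤ r ^ (n + 1) * ‖x - y‖ :=
      (norm_mul_le _ _).trans (by gcongr; exact (norm_pow_le x _).trans (by gcongr))
    have h2 : ‖(x ^ (n + 1) - y ^ (n + 1)) * y‖ ≤ (n + 1) * r ^ n * ‖x - y‖ * r :=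
      (norm_mul_le _ _).trans (by gcongr)
    refine (norm_add_le _ _).trans ((add_le_add h1 h2).trans (le_of_eq ?_))
    push_cast; ring

variable [NormedAlgebra ℝ 𝔸]

theorem NormedSpace.norm_exp_le_exp_norm (x : 𝔸) : ‖exp x‖ ≤ Real.exp ‖x‖ := by
  rw [Real.exp_eq_exp_ℝ, exp_eq_tsum ℝ, exp_eq_tsum ℝ]
  refine tsum_of_norm_bounded (expSeries_summable' (𝕂 := ℝ) ‖x‖).hasSum fun n => ?_
  rw [norm_smul]
  simp only [norm_inv, smul_eq_mul, Real.norm_natCast]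
  gcongr
  exact norm_pow_le x n

variable [CompleteSpace 𝔸]

/-- The **Lie product formula** in a Banach algebra. -/
theorem tendsto_exp_mul_exp_pow (a b : 𝔸) :
    Tendsto (fun n : ℕ => (exp ((1 / ((n : ℝ) + 1)) • a) * exp ((1 / ((n : ℝ) + 1)) • b)) ^ (n + 1))
      atTop (𝓝 (exp (a + b))) := by
  -- Both curves agree to first order at `0`, so they differ by `o(s)` at `s = 1 / (n + 1)`; this
  -- survives the factor `n + 1` from telescoping.
  have hF : HasDerivAt (fun t : ℝ => exp (t • a) * exp (t • b) - exp (t • (a + b))) 0 0 := by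
    have h := ((hasDerivAt_exp_smul_const (𝕂 := ℝ) a 0).mul
      (hasDerivAt_exp_smul_const (𝕂 := ℝ) b 0)).sub (hasDerivAt_exp_smul_const (𝕂 := ℝ) (a + b) 0)
    simp only [zero_smul, exp_zero, mul_one, one_mul, sub_self] at h
    exact h
  have ho := hF.isLittleO
  simp only [sub_zero, zero_smul, exp_zero, mul_one, sub_self, smul_zero] at ho
  have ht : Tendsto (fun n : ℕ => 1 / ((n : ℝ) + 1)) atTop (𝓝 0) :=
    tendsto_one_div_add_atTop_nhds_zero_nat
  have ho' := (ho.comp_tendsto ht).norm_left.tendsto_div_nhds_zero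
  rw [tendsto_iff_norm_sub_tendsto_zero]
  set R := ‖a‖ + ‖b‖
  have hlim := ho'.const_mul (Real.exp R)
  rw [mul_zero] at hlim
  refine squeeze_zero (fun _ => norm_nonneg _) (fun n => ?_) hlim
  have hn : (0 : ℝ) < (n : ℝ) + 1 := by positivity
  set s : ℝ := 1 / ((n : ℝ) + 1) with hs
  have hs0 : 0 ≤ s := by positivity
  have hexp : exp (a + b) = exp (s • (a + b)) ^ (n + 1) := by
    let _ : NormedAlgebra ℚ 𝔸 := NormedAlgebra.restrictScalars ℚ ℝ 𝔸
    rw [← exp_nsmul, ← Nat.cast_smul_eq_nsmul ℝ, smul_smul, hs]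
    push_cast
    rw [mul_one_div_cancel hn.ne', one_smul]
  rw [hexp]
  have hx : ‖exp (s • a) * exp (s • b)‖ ≤ Real.exp (s * R) := by
    refine (norm_mul_le _ _).trans ?_
    rw [mul_add, Real.exp_add]
    gcongr
    · exact (norm_exp_le_exp_norm _).trans (by rw [norm_smul, Real.norm_of_nonneg hs0])
    · exact (norm_exp_le_exp_norm _).trans (by rw [norm_smul, Real.norm_of_nonneg hs0])
  have hy : ‖exp (s • (a + b))‖ ≤ Real.exp (s * R) := by
    refine (norm_exp_le_exp_norm _).trans (Real.exp_le_exp.2 ?_)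
    rw [norm_smul, Real.norm_of_nonneg hs0]
    gcongr
    exact norm_add_le _ _
  refine (norm_pow_sub_pow_le (Real.exp_pos _).le hx hy n).trans ?_
  have hr : Real.exp (s * R) ^ n ≤ Real.exp R := by
    rw [← Real.exp_nat_mul]
    refine Real.exp_le_exp.2 ?_
    have : (n : ℝ) * s ≤ 1 := by rw [hs, mul_one_div, div_le_one hn]; linarith
    have hR : 0 ≤ R := by positivity
    nlinarith
  simp only [Function.comp_apply]
  rw [← hs]
  set D := ‖exp (s • a) * exp (s • b) - exp (s • (a + b))‖
  have hD : 0 ≤ D := norm_nonneg _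
  have : D / s = (n + 1) * D := by rw [hs]; field_simp
  rw [this]
  nlinarith [mul_nonneg hn.le hD]

end LieProduct

/-! ### The Golden-Thompson inequality. -/

section GoldenThompson
open Matrix Filter Topology NormedSpace
open scoped Matrix.Norms.L2Operator

variable {ι : Type*} [Fintype ι] [DecidableEq ι]

/-- The **Golden-Thompson inequality** for real symmetric matrices. -/
theorem Matrix.trace_exp_add_le {A B : Matrix ι ι ℝ} (hA : A.IsHermitian) (hB : B.IsHermitian) :
    (exp (A + B)).trace ≤ (exp A * exp B).trace := by
  rcases isEmpty_or_nonempty ι with h | h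
  · simp [Matrix.trace]
  have h1 := tendsto_exp_mul_exp_pow A B
  -- The Lie formula has exponent `n + 1`; the indices `2 ^ k - 1` select the exponents `2 ^ k` that
  -- Lieb-Thirring covers.
  have hsub : Tendsto (fun k : ℕ => 2 ^ k - 1) atTop atTop :=
    tendsto_atTop_mono (fun k => Nat.le_sub_one_of_lt k.lt_two_pow_self) tendsto_id
  have h2 := h1.comp hsub
  have h3 : Tendsto (fun M : Matrix ι ι ℝ => M.trace) (𝓝 (exp (A + B)))
      (𝓝 (exp (A + B)).trace) := (continuous_id.matrix_trace).tendsto _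
  refine le_of_tendsto (h3.comp h2) (Eventually.of_forall fun k => ?_)
  have hk : ((2 ^ k - 1 : ℕ) : ℝ) + 1 = ((2 ^ k : ℕ) : ℝ) := by
    rw [← Nat.cast_add_one, Nat.sub_add_cancel Nat.one_le_two_pow]
  have hk' : 2 ^ k - 1 + 1 = 2 ^ k := Nat.sub_add_cancel Nat.one_le_two_pow
  simp only [Function.comp_apply, hk, hk']
  have hpow (C : Matrix ι ι ℝ) : exp ((1 / ((2 ^ k : ℕ) : ℝ)) • C) ^ 2 ^ k = exp C := by
    rw [← Matrix.exp_nsmul, ← Nat.cast_smul_eq_nsmul ℝ, smul_smul, mul_one_div_cancel, one_smul]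
    positivity
  have h4 := (trace_two_pow_le k).2 _ _ (hA.smul (k := 1 / ((2 ^ k : ℕ) : ℝ)) (.all _)).exp
    (hB.smul (k := 1 / ((2 ^ k : ℕ) : ℝ)) (.all _)).exp
  rwa [hpow, hpow] at h4

end GoldenThompson

/-! ### Exponentials of symmetric matrices through diagonalization. -/

section HermitianExponential
open Matrix NormedSpace
open scoped Matrix.Norms.L2Operator

variable {ι : Type*} [Fintype ι] [DecidableEq ι]

theorem Matrix.IsHermitian.exists_diagonalization {A : Matrix ι ι ℝ} (hA : A.IsHermitian) :
    ∃ (U : Matrix.unitaryGroup ι ℝ) (l : ι → ℝ),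
      A = (U : Matrix ι ι ℝ) * diagonal l * (U : Matrix ι ι ℝ)ᴴ :=
  ⟨hA.eigenvectorUnitary, hA.eigenvalues, by
    conv_lhs => rw [hA.spectral_theorem, Unitary.conjStarAlgAut_apply]
    rfl⟩

theorem Matrix.exp_unitary_conj_diagonal (U : Matrix.unitaryGroup ι ℝ) (l : ι → ℝ) :
    exp ((U : Matrix ι ι ℝ) * diagonal l * (U : Matrix ι ι ℝ)ᴴ)
      = (U : Matrix ι ι ℝ) * diagonal (fun i => Real.exp (l i)) * (U : Matrix ι ι ℝ)ᴴ := by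
  have hU : (U : Matrix ι ι ℝ)ᴴ = (U : Matrix ι ι ℝ)⁻¹ :=
    (inv_eq_left_inv (Unitary.coe_star_mul_self U)).symm
  have hu : IsUnit (U : Matrix ι ι ℝ) := (Unitary.toUnits U).isUnit
  rw [hU, Matrix.exp_conj _ _ hu, Matrix.exp_diagonal]
  congr 3
  ext i
  rw [Pi.coe_exp, Real.exp_eq_exp_ℝ]

theorem Matrix.trace_unitary_conj (U : Matrix.unitaryGroup ι ℝ) (B : Matrix ι ι ℝ) :
    ((U : Matrix ι ι ℝ) * B * (U : Matrix ι ι ℝ)ᴴ).trace = B.trace := by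
  rw [mul_assoc, trace_mul_comm, mul_assoc]
  have : (U : Matrix ι ι ℝ)ᴴ * (U : Matrix ι ι ℝ) = 1 := Unitary.coe_star_mul_self U
  rw [this, mul_one]

theorem Matrix.norm_unitary_conj (U : Matrix.unitaryGroup ι ℝ) (B : Matrix ι ι ℝ) :
    ‖(U : Matrix ι ι ℝ) * B * (U : Matrix ι ι ℝ)ᴴ‖ = ‖B‖ := by
  have : (U : Matrix ι ι ℝ)ᴴ = ((star U : Matrix.unitaryGroup ι ℝ) : Matrix ι ι ℝ) := rfl
  rw [this, CStarRing.norm_mul_coe_unitary, CStarRing.norm_coe_unitary_mul]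

/-- The norm is some `|l i|`, and `exp |l i|` is at most the `i`-th term of the sum of the two
traces. Both signs are needed to control the norm and not only the top eigenvalue. -/
theorem Matrix.IsHermitian.exp_norm_le_trace [Nonempty ι] {A : Matrix ι ι ℝ}
    (hA : A.IsHermitian) :
    Real.exp ‖A‖ ≤ (NormedSpace.exp A).trace + (NormedSpace.exp (-A)).trace := by
  obtain ⟨U, l, rfl⟩ := hA.exists_diagonalization
  have hneg : -((U : Matrix ι ι ℝ) * diagonal l * (U : Matrix ι ι ℝ)ᴴ)
      = (U : Matrix ι ι ℝ) * diagonal (-l) * (U : Matrix ι ι ℝ)ᴴ := by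
    rw [← Matrix.neg_mul, ← Matrix.mul_neg, diagonal_neg]; rfl
  rw [hneg, exp_unitary_conj_diagonal, exp_unitary_conj_diagonal, trace_unitary_conj,
    trace_unitary_conj, norm_unitary_conj, l2_opNorm_diagonal, trace_diagonal, trace_diagonal,
    ← Finset.sum_add_distrib]
  obtain ⟨i, hi⟩ := exists_eq_ciSup_of_finite (f := fun i => ‖l i‖)
  have hl : ‖l‖ = ‖l i‖ := le_antisymm ((pi_norm_le_iff_of_nonneg (norm_nonneg _)).2 fun j => by
    rw [hi]; exact le_ciSup (f := fun i => ‖l i‖) (Set.finite_range _).bddAbove j)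
    (norm_le_pi_norm l i)
  rw [hl]
  refine le_trans ?_ (Finset.single_le_sum (f := fun i => Real.exp (l i) + Real.exp ((-l) i))
    (fun j _ => by positivity) (Finset.mem_univ i))
  rw [Real.norm_eq_abs]
  simp only [Pi.neg_apply]
  rcases abs_choice (l i) with h | h <;> rw [h] <;>
    linarith [Real.exp_pos (l i), Real.exp_pos (-l i)]

theorem Real.exp_le_one_add_add_sq {x : ℝ} (hx : |x| ≤ 1) : Real.exp x ≤ 1 + x + x ^ 2 := by
  have := (abs_le.1 (Real.abs_exp_sub_one_sub_id_le hx)).2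
  linarith

/-- In an eigenbasis this is `exp x ≤ 1 + x + x ^ 2` for `|x| ≤ 1`, whence the normalization to norm
at most one in the Bernstein bound. -/
theorem Matrix.IsHermitian.posSemidef_sub_exp {A : Matrix ι ι ℝ} (hA : A.IsHermitian)
    (h : ‖A‖ ≤ 1) : (1 + A + A * A - NormedSpace.exp A).PosSemidef := by
  obtain ⟨U, l, rfl⟩ := hA.exists_diagonalization
  rw [norm_unitary_conj, l2_opNorm_diagonal] at h
  have hU : (U : Matrix ι ι ℝ)ᴴ * (U : Matrix ι ι ℝ) = 1 := Unitary.coe_star_mul_self U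
  have hU' : (U : Matrix ι ι ℝ) * (U : Matrix ι ι ℝ)ᴴ = 1 := Unitary.coe_mul_star_self U
  have key : 1 + (U : Matrix ι ι ℝ) * diagonal l * (U : Matrix ι ι ℝ)ᴴ
      + (U : Matrix ι ι ℝ) * diagonal l * (U : Matrix ι ι ℝ)ᴴ
        * ((U : Matrix ι ι ℝ) * diagonal l * (U : Matrix ι ι ℝ)ᴴ)
      - NormedSpace.exp ((U : Matrix ι ι ℝ) * diagonal l * (U : Matrix ι ι ℝ)ᴴ)
      = (U : Matrix ι ι ℝ) * diagonal (fun i => 1 + l i + l i ^ 2 - Real.exp (l i))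
        * (U : Matrix ι ι ℝ)ᴴ := by
    have h1 : diagonal (fun i => 1 + l i + l i ^ 2 - Real.exp (l i))
        = 1 + diagonal l + diagonal l * diagonal l - diagonal (fun i => Real.exp (l i)) := by
      rw [diagonal_mul_diagonal, ← diagonal_one, diagonal_add, diagonal_add, diagonal_sub]
      simp only [pow_two]
    have h2 : (U : Matrix ι ι ℝ) * diagonal l * (U : Matrix ι ι ℝ)ᴴ
        * ((U : Matrix ι ι ℝ) * diagonal l * (U : Matrix ι ι ℝ)ᴴ)
        = (U : Matrix ι ι ℝ) * (diagonal l * diagonal l) * (U : Matrix ι ι ℝ)ᴴ := by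
      calc _ = (U : Matrix ι ι ℝ) * diagonal l * ((U : Matrix ι ι ℝ)ᴴ * (U : Matrix ι ι ℝ))
            * diagonal l * (U : Matrix ι ι ℝ)ᴴ := by simp only [mul_assoc]
        _ = _ := by rw [hU]; simp only [mul_assoc, one_mul]
    rw [exp_unitary_conj_diagonal, h1, h2]
    simp only [Matrix.mul_add, Matrix.mul_sub, Matrix.add_mul, Matrix.sub_mul, mul_one, hU']
  rw [key]
  refine (PosSemidef.diagonal fun i => ?_).mul_mul_conjTranspose_same _
  have := Real.exp_le_one_add_add_sq (x := l i) ((norm_le_pi_norm l i).trans h)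
  simp only [Pi.zero_apply]
  linarith

theorem Matrix.IsHermitian.posSemidef_exp {A : Matrix ι ι ℝ} (hA : A.IsHermitian) :
    (NormedSpace.exp A).PosSemidef := by
  obtain ⟨U, l, rfl⟩ := hA.exists_diagonalization
  rw [exp_unitary_conj_diagonal]
  exact (PosSemidef.diagonal fun i => (Real.exp_pos _).le).mul_mul_conjTranspose_same _

/-- Write `A = Cᴴ * C` and cycle to the trace of `C * B * Cᴴ`. -/
theorem Matrix.PosSemidef.trace_mul_nonneg {A B : Matrix ι ι ℝ} (hA : A.PosSemidef)
    (hB : B.PosSemidef) : 0 ≤ (A * B).trace := by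
  obtain ⟨C, rfl⟩ : ∃ C : Matrix ι ι ℝ, A = Cᴴ * C := by
    open scoped MatrixOrder in
    exact CStarAlgebra.nonneg_iff_eq_star_mul_self.1 (Matrix.nonneg_iff_posSemidef.2 hA)
  rw [mul_assoc, trace_mul_comm]
  exact (hB.mul_mul_conjTranspose_same C).trace_nonneg

end HermitianExponential

/-! ### Integration of matrix-valued functions. -/

section MatrixIntegral
open Matrix NormedSpace
open scoped Matrix.Norms.L2Operator

instance Matrix.instMeasurableSpaceReal {m n : Type*} : MeasurableSpace (Matrix m n ℝ) :=
  inferInstanceAs (MeasurableSpace (m → n → ℝ))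

instance Matrix.instBorelSpaceReal {m n : Type*} [Countable m] [Countable n] :
    BorelSpace (Matrix m n ℝ) :=
  inferInstanceAs (BorelSpace (m → n → ℝ))

instance Matrix.instSecondCountableReal {m n : Type*} [Countable m] [Countable n] :
    SecondCountableTopology (Matrix m n ℝ) :=
  inferInstanceAs (SecondCountableTopology (m → n → ℝ))

variable {ι : Type*} [Fintype ι] [DecidableEq ι]
variable {Ω : Type*} [MeasurableSpace Ω] {P : Measure Ω}

theorem Matrix.integral_trace_mul_left {F : Ω → Matrix ι ι ℝ} (hF : Integrable F P)
    (B : Matrix ι ι ℝ) :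
    ∫ ω, (F ω * B).trace ∂P = ((∫ ω, F ω ∂P) * B).trace := by
  let T : Matrix ι ι ℝ →L[ℝ] ℝ :=
    LinearMap.toContinuousLinearMap ((traceLinearMap ι ℝ ℝ).comp (LinearMap.mulRight ℝ B))
  exact T.integral_comp_comm hF

theorem Matrix.integral_apply {F : Ω → Matrix ι ι ℝ} (hF : Integrable F P) (i j : ι) :
    (∫ ω, F ω ∂P) i j = ∫ ω, F ω i j ∂P := by
  let T : Matrix ι ι ℝ →L[ℝ] ℝ := LinearMap.toContinuousLinearMap (entryLinearMap ℝ ℝ i j)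
  exact (T.integral_comp_comm hF).symm

theorem Matrix.integral_dotProduct_mulVec {F : Ω → Matrix ι ι ℝ} (hF : Integrable F P)
    (v w : ι → ℝ) :
    v ⬝ᵥ (∫ ω, F ω ∂P) *ᵥ w = ∫ ω, v ⬝ᵥ F ω *ᵥ w ∂P := by
  let T : Matrix ι ι ℝ →L[ℝ] ℝ := LinearMap.toContinuousLinearMap
    { toFun := fun M => v ⬝ᵥ M *ᵥ w
      map_add' := fun M N => by rw [add_mulVec, dotProduct_add]
      map_smul' := fun c M => by rw [smul_mulVec, dotProduct_smul]; rfl }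
  exact (T.integral_comp_comm hF).symm

theorem Matrix.integrable_of_apply {F : Ω → Matrix ι ι ℝ}
    (h : ∀ i j, Integrable (fun ω => F ω i j) P) :
    Integrable F P := by
  have : F = fun ω => ∑ i, ∑ j, F ω i j • single i j (1 : ℝ) := by
    ext1 ω
    conv_lhs => rw [matrix_eq_sum_single (F ω)]
    simp only [smul_single, smul_eq_mul, mul_one]
  rw [this]
  exact integrable_finsetSum _ fun i _ => integrable_finsetSum _ fun j _ => (h i j).smul_const _

theorem Matrix.isHermitian_integral {F : Ω → Matrix ι ι ℝ} (hF : Integrable F P)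
    (h : ∀ᵐ ω ∂P, (F ω).IsHermitian) : (∫ ω, F ω ∂P).IsHermitian := by
  ext i j
  simp only [conjTranspose_apply, star_trivial]
  rw [integral_apply hF, integral_apply hF]
  refine integral_congr_ae (h.mono fun ω hω => ?_)
  simpa using hω.apply i j

theorem Matrix.posSemidef_integral {F : Ω → Matrix ι ι ℝ} (hF : Integrable F P)
    (h : ∀ᵐ ω ∂P, (F ω).PosSemidef) : (∫ ω, F ω ∂P).PosSemidef := by
  refine PosSemidef.of_dotProduct_mulVec_nonneg
    (isHermitian_integral hF (h.mono fun _ h => h.1)) fun v => ?_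
  rw [integral_dotProduct_mulVec hF]
  exact integral_nonneg_of_ae (h.mono fun ω hω => hω.dotProduct_mulVec_nonneg v)

theorem Matrix.continuous_exp : Continuous (exp : Matrix ι ι ℝ → Matrix ι ι ℝ) := by
  let _ : NormedAlgebra ℚ (Matrix ι ι ℝ) := NormedAlgebra.restrictScalars ℚ ℝ _
  exact NormedSpace.exp_continuous

end MatrixIntegral

/-! ### Matrix Bernstein inequality. -/

section MatrixBernstein
open Matrix NormedSpace
open scoped Matrix.Norms.L2Operator

variable {ι κ : Type*} [Fintype ι] [DecidableEq ι]
variable {Ω : Type*} [MeasurableSpace Ω] {P : Measure Ω} [IsProbabilityMeasure P]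

theorem Matrix.integrable_of_norm_le {F : Ω → Matrix ι ι ℝ} (hm : AEMeasurable F P) (R : ℝ)
    (hb : ∀ᵐ ω ∂P, ‖F ω‖ ≤ R) : Integrable F P :=
  .of_bound hm.aestronglyMeasurable R hb

variable [Nonempty ι]

theorem Matrix.integrable_exp_of_norm_le {F : Ω → Matrix ι ι ℝ} (hm : AEMeasurable F P) (R : ℝ)
    (hb : ∀ᵐ ω ∂P, ‖F ω‖ ≤ R) : Integrable (fun ω => exp (F ω)) P := by
  refine integrable_of_norm_le (continuous_exp.measurable.comp_aemeasurable hm) (Real.exp R)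
    (hb.mono fun ω hω => (NormedSpace.norm_exp_le_exp_norm _).trans (Real.exp_le_exp.2 hω))

/-- Integrate `exp S ⪯ 1 + S + S * S`: centring removes the linear term and `v` bounds the quadratic
one. -/
theorem Matrix.posSemidef_sub_integral_exp {S : Ω → Matrix ι ι ℝ} {v : ℝ} (hm : AEMeasurable S P)
    (hs : ∀ᵐ ω ∂P, (S ω).IsHermitian) (hb : ∀ᵐ ω ∂P, ‖S ω‖ ≤ 1) (h0 : ∫ ω, S ω ∂P = 0)
    (hv : (v • (1 : Matrix ι ι ℝ) - ∫ ω, S ω * S ω ∂P).PosSemidef) :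
    ((1 + v) • (1 : Matrix ι ι ℝ) - ∫ ω, exp (S ω) ∂P).PosSemidef := by
  have i1 := integrable_of_norm_le hm 1 hb
  have i2 : Integrable (fun ω => S ω * S ω) P := by
    refine integrable_of_norm_le
      (hm.aestronglyMeasurable.mul hm.aestronglyMeasurable).aemeasurable 1
      (hb.mono fun ω hω => (norm_mul_le _ _).trans ?_)
    nlinarith [norm_nonneg (S ω)]
  have i3 := integrable_exp_of_norm_le hm 1 hb
  have i0 : Integrable (fun _ : Ω => (1 : Matrix ι ι ℝ)) P := integrable_const _
  have i4 : Integrable (fun ω => 1 + S ω) P := i0.add i1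
  have i5 : Integrable (fun ω => 1 + S ω + S ω * S ω) P := i4.add i2
  have i6 : Integrable (fun ω => 1 + S ω + S ω * S ω - exp (S ω)) P := i5.sub i3
  have h := posSemidef_integral i6
    (by filter_upwards [hs, hb] with ω h1 h2 using h1.posSemidef_sub_exp h2)
  have h' : ∫ ω, (1 + S ω + S ω * S ω - exp (S ω)) ∂P
      = 1 + ∫ ω, S ω * S ω ∂P - ∫ ω, exp (S ω) ∂P := by
    rw [integral_sub i5 i3, integral_add i4 i2, integral_add i0 i1, h0]
    simp
  have h2 := hv.add (h' ▸ h)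
  convert h2 using 1
  rw [add_smul, one_smul]
  abel

/-- The trace of the exponential of a sum of independent centred bounded symmetric random
matrices, bounded by the Ahlswede-Winter method. -/
theorem Matrix.integral_trace_exp_sum_le {S : κ → Ω → Matrix ι ι ℝ} {v : ℝ}
    (hind : iIndepFun S P) (hm : ∀ i, AEMeasurable (S i) P)
    (hs : ∀ i, ∀ᵐ ω ∂P, (S i ω).IsHermitian) (hb : ∀ i, ∀ᵐ ω ∂P, ‖S i ω‖ ≤ 1)
    (h0 : ∀ i, ∫ ω, S i ω ∂P = 0)
    (hv : ∀ i, (v • (1 : Matrix ι ι ℝ) - ∫ ω, S i ω * S i ω ∂P).PosSemidef)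
    (hv0 : 0 ≤ v) (s : Finset κ) :
    ∫ ω, (exp (∑ i ∈ s, S i ω)).trace ∂P ≤ Fintype.card ι * Real.exp (s.card * v) := by
  classical
  have hsm (s : Finset κ) : AEMeasurable (fun ω => ∑ i ∈ s, S i ω) P :=
    (Finset.aestronglyMeasurable_fun_sum s fun i _ => (hm i).aestronglyMeasurable).aemeasurable
  have hsb (s : Finset κ) : ∀ᵐ ω ∂P, ‖∑ i ∈ s, S i ω‖ ≤ s.card := by
    have : ∀ᵐ ω ∂P, ∀ i ∈ s, ‖S i ω‖ ≤ 1 := (Finset.eventually_all s).2 fun i _ => hb i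
    filter_upwards [this] with ω hω
    simpa using norm_sum_le_of_le s hω
  have hss (s : Finset κ) : ∀ᵐ ω ∂P, (∑ i ∈ s, S i ω).IsHermitian := by
    have : ∀ᵐ ω ∂P, ∀ i ∈ s, (S i ω).IsHermitian := (Finset.eventually_all s).2 fun i _ => hs i
    filter_upwards [this] with ω hω
    rw [IsHermitian, conjTranspose_sum]
    exact Finset.sum_congr rfl hω
  induction s using Finset.induction_on with
  | empty => simp
  | insert a s ha ih =>
    have iY := integrable_exp_of_norm_le (hsm s) _ (hsb s)
    have iS := integrable_exp_of_norm_le (hm a) 1 (hb a)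
    have hYS : IndepFun (fun ω => exp (∑ i ∈ s, S i ω)) (fun ω => exp (S a ω)) P := by
      have h := hind.indepFun_finsetSum_of_notMem₀ hm ha
      have h' := h.comp (φ := exp) (ψ := exp) continuous_exp.measurable continuous_exp.measurable
      refine h'.congr (Filter.EventuallyEq.of_eq ?_) .rfl
      ext1 ω
      simp
    let B : Matrix ι ι ℝ →L[ℝ] Matrix ι ι ℝ →L[ℝ] Matrix ι ι ℝ := ContinuousLinearMap.mul ℝ _
    have hprod : ∫ ω, exp (∑ i ∈ s, S i ω) * exp (S a ω) ∂P
        = (∫ ω, exp (∑ i ∈ s, S i ω) ∂P) * ∫ ω, exp (S a ω) ∂P := hYS.integral_bilin iY iS B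
    have iprod : Integrable (fun ω => exp (∑ i ∈ s, S i ω) * exp (S a ω)) P := by
      refine integrable_of_norm_le (iY.1.mul iS.1).aemeasurable (Real.exp s.card * Real.exp 1) ?_
      filter_upwards [hsb s, hb a] with ω h1 h2
      refine (norm_mul_le _ _).trans ?_
      gcongr
      · exact (NormedSpace.norm_exp_le_exp_norm _).trans (Real.exp_le_exp.2 h1)
      · exact (NormedSpace.norm_exp_le_exp_norm _).trans (Real.exp_le_exp.2 h2)
    have itr {F : Ω → Matrix ι ι ℝ} (hF : Integrable F P) : Integrable (fun ω => (F ω).trace) P :=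
      (LinearMap.toContinuousLinearMap (traceLinearMap ι ℝ ℝ)).integrable_comp hF
    have ctr {F : Ω → Matrix ι ι ℝ} (hF : Integrable F P) :
        ∫ ω, (F ω).trace ∂P = (∫ ω, F ω ∂P).trace := by
      simpa using integral_trace_mul_left hF 1
    have hE := posSemidef_integral iY ((hss s).mono fun ω h => h.posSemidef_exp)
    -- By independence the expected product of exponentials factors, and the factor of the new
    -- summand is replaced by the scalar `1 + v` under the trace.
    have hnn := hE.trace_mul_nonneg (posSemidef_sub_integral_exp (hm a) (hs a) (hb a) (h0 a) (hv a))
    rw [mul_sub, trace_sub, Matrix.mul_smul, mul_one, trace_smul, smul_eq_mul, ← ctr iY,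
      ← hprod, ← ctr iprod] at hnn
    have hGT : ∫ ω, (exp (∑ i ∈ insert a s, S i ω)).trace ∂P
        ≤ ∫ ω, (exp (∑ i ∈ s, S i ω) * exp (S a ω)).trace ∂P := by
      refine integral_mono_ae
        (itr (integrable_exp_of_norm_le (hsm _) _ (hsb _))) (itr iprod) ?_
      filter_upwards [hss s, hs a] with ω h1 h2
      rw [Finset.sum_insert ha, add_comm]
      exact trace_exp_add_le h1 h2
    rw [Finset.card_insert_of_notMem ha]
    push_cast
    have hexp : Real.exp ((s.card + 1) * v) = Real.exp (s.card * v) * Real.exp v := by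
      rw [← Real.exp_add]; ring_nf
    rw [hexp]
    have h1 : (1 + v) ≤ Real.exp v := by linarith [Real.add_one_le_exp v]
    calc _ ≤ (1 + v) * ∫ ω, (exp (∑ i ∈ s, S i ω)).trace ∂P := by linarith
      _ ≤ Real.exp v * (Fintype.card ι * Real.exp (s.card * v)) := by
          gcongr
          exact integral_nonneg_of_ae ((hss s).mono fun ω h => h.posSemidef_exp.trace_nonneg)
      _ = _ := by ring

/-- A **matrix Bernstein inequality** for independent centred symmetric random matrices of norm
at most one. -/
theorem Matrix.measureReal_lt_norm_sum_le [Fintype κ] {S : κ → Ω → Matrix ι ι ℝ} {v : ℝ}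
    (hind : iIndepFun S P) (hm : ∀ i, AEMeasurable (S i) P)
    (hs : ∀ i, ∀ᵐ ω ∂P, (S i ω).IsHermitian) (hb : ∀ i, ∀ᵐ ω ∂P, ‖S i ω‖ ≤ 1)
    (h0 : ∀ i, ∫ ω, S i ω ∂P = 0)
    (hv : ∀ i, (v • (1 : Matrix ι ι ℝ) - ∫ ω, S i ω * S i ω ∂P).PosSemidef)
    (hv0 : 0 ≤ v) (t : ℝ) :
    P.real {ω | t < ‖∑ i, S i ω‖}
      ≤ 2 * Fintype.card ι * Real.exp (Fintype.card κ * v - t) := by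
  have hsm : AEMeasurable (fun ω => ∑ i, S i ω) P :=
    (Finset.aestronglyMeasurable_fun_sum _ fun i _ => (hm i).aestronglyMeasurable).aemeasurable
  have hsb : ∀ᵐ ω ∂P, ‖∑ i, S i ω‖ ≤ Fintype.card κ := by
    filter_upwards [ae_all_iff.2 hb] with ω hω
    simpa using norm_sum_le_of_le Finset.univ fun i _ => hω i
  have hss : ∀ᵐ ω ∂P, (∑ i, S i ω).IsHermitian := by
    filter_upwards [ae_all_iff.2 hs] with ω hω
    rw [IsHermitian, conjTranspose_sum]
    exact Finset.sum_congr rfl fun i _ => hω i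
  have itr {F : Ω → Matrix ι ι ℝ} (hF : Integrable F P) : Integrable (fun ω => (F ω).trace) P :=
    (LinearMap.toContinuousLinearMap (traceLinearMap ι ℝ ℝ)).integrable_comp hF
  have i1 := itr (integrable_exp_of_norm_le hsm _ hsb)
  have i2 := itr (integrable_exp_of_norm_le (F := fun ω => -∑ i, S i ω) hsm.neg _
    (hsb.mono fun ω h => by simpa using h))
  have e1 := integral_trace_exp_sum_le hind hm hs hb h0 hv hv0 Finset.univ
  have e2 := integral_trace_exp_sum_le (S := fun i ω => -S i ω) (v := v)
    (hind.comp (fun _ => Neg.neg) (fun _ => continuous_neg.measurable)) (fun i => (hm i).neg)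
    (fun i => (hs i).mono fun ω h => h.neg) (fun i => (hb i).mono fun ω h => by simpa using h)
    (fun i => by rw [integral_neg, h0 i, neg_zero]) (fun i => by simpa using hv i) hv0 Finset.univ
  simp only [Finset.sum_neg_distrib] at e2
  rw [Finset.card_univ] at e1 e2
  have hnn : 0 ≤ᵐ[P] fun ω => (exp (∑ i, S i ω)).trace + (exp (-∑ i, S i ω)).trace := by
    filter_upwards [hss] with ω hω
    exact add_nonneg hω.posSemidef_exp.trace_nonneg hω.neg.posSemidef_exp.trace_nonneg
  -- Markov's inequality at level `exp t`; the Laplace parameter is left to the scaling of `S`.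
  have hM := mul_meas_ge_le_integral_of_nonneg hnn (i1.add i2) (Real.exp t)
  have hsub : P.real {ω | t < ‖∑ i, S i ω‖}
      ≤ P.real {ω | Real.exp t ≤ (exp (∑ i, S i ω)).trace + (exp (-∑ i, S i ω)).trace} := by
    refine ENNReal.toReal_mono (measure_ne_top _ _) (measure_mono_ae ?_)
    filter_upwards [hss] with ω hω h
    exact (Real.exp_le_exp.2 (le_of_lt h)).trans hω.exp_norm_le_trace
  refine hsub.trans ?_
  rw [integral_add i1 i2] at hM
  rw [Real.exp_sub, mul_div_assoc', le_div_iff₀ (Real.exp_pos t), mul_comm]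
  refine hM.trans ?_
  linarith

end MatrixBernstein

/-! ### The dither law as a product of triangular laws. -/

section DitherLaw

/-- The uniform distribution on `[-η/2, η/2]`. -/
noncomputable def uniformInterval (η : ℝ) : Measure ℝ :=
  cond volume (Set.Icc (-(η / 2)) (η / 2))

/-- The law of the sum of two independent uniform variables on `[-η/2, η/2]`. -/
noncomputable def triangularLaw (η : ℝ) : Measure ℝ :=
  (uniformInterval η).conv (uniformInterval η)

theorem volume_Icc_half (η : ℝ) :
    volume (Set.Icc (-(η / 2)) (η / 2)) = ENNReal.ofReal η := by
  rw [Real.volume_Icc]; congr 1; ring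

theorem isProbabilityMeasure_uniformInterval {η : ℝ} (hη : 0 < η) :
    IsProbabilityMeasure (uniformInterval η) :=
  cond_isProbabilityMeasure_of_finite (by rw [volume_Icc_half]; simpa using hη)
    (by rw [volume_Icc_half]; simp)

/-- For `η ≤ 0` the interval is null and the conditioned measure is zero, so products of these
measures make sense for every `η`. -/
instance sigmaFinite_uniformInterval (η : ℝ) : SigmaFinite (uniformInterval η) := by
  rcases le_or_gt η 0 with h | h
  · have h0 : volume.restrict (Set.Icc (-(η / 2)) (η / 2)) = 0 := by
      rw [Measure.restrict_eq_zero, volume_Icc_half]; simpa using h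
    rw [uniformInterval, ProbabilityTheory.cond, h0, smul_zero]
    infer_instance
  · have := isProbabilityMeasure_uniformInterval h
    infer_instance

theorem isProbabilityMeasure_triangularLaw {η : ℝ} (hη : 0 < η) :
    IsProbabilityMeasure (triangularLaw η) := by
  have := isProbabilityMeasure_uniformInterval hη
  rw [triangularLaw]
  infer_instance

theorem measurableSet_cube (d : ℕ) (η : ℝ) : MeasurableSet (cube d η) := by
  have : cube d η = ⋂ j,
      (fun x : EuclideanSpace ℝ (Fin d) => x j) ⁻¹' Set.Icc (-(η / 2)) (η / 2) := by
    ext x; simp [cube]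
  rw [this]
  exact MeasurableSet.iInter fun j =>
    (by fun_prop : Measurable fun x : EuclideanSpace ℝ (Fin d) => x j) measurableSet_Icc

theorem map_toLp_pi_uniformInterval (d : ℕ) (η : ℝ) :
    (Measure.pi fun _ : Fin d => uniformInterval η).map (WithLp.toLp 2) = uniformCube d η := by
  have hpre : (WithLp.toLp 2 : (Fin d → ℝ) → EuclideanSpace ℝ (Fin d)) ⁻¹' cube d η
      = Set.univ.pi fun _ => Set.Icc (-(η / 2)) (η / 2) := by
    ext x; simp only [cube, Set.mem_preimage, Set.mem_ofPred_eq, Set.mem_univ_pi]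
  have hmp := PiLp.volume_preserving_toLp (Fin d)
  have hr := hmp.restrict_preimage (measurableSet_cube d η)
  have hv : volume (cube d η) = ENNReal.ofReal η ^ d := by
    rw [← hmp.measure_preimage (measurableSet_cube d η).nullMeasurableSet, hpre, volume_pi_pi]
    simp only [volume_Icc_half, Finset.prod_const, Finset.card_univ, Fintype.card_fin]
  have hpi : (Measure.pi fun _ : Fin d => uniformInterval η)
      = (ENNReal.ofReal η ^ d)⁻¹ • volume.restrict
        (Set.univ.pi fun _ : Fin d => Set.Icc (-(η / 2)) (η / 2)) := by
    refine Measure.pi_eq fun s hs => ?_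
    rw [Measure.smul_apply, Measure.restrict_apply (MeasurableSet.univ_pi hs),
      ← Set.pi_inter_distrib,
      volume_pi_pi, smul_eq_mul]
    simp only [uniformInterval, cond_apply measurableSet_Icc, volume_Icc_half,
      Finset.prod_mul_distrib,
      Finset.prod_const, Finset.card_univ, Fintype.card_fin, ENNReal.inv_pow]
    congr 2
    ext j
    rw [Set.inter_comm]
  rw [hpi, Measure.map_smul, ← hpre, hr.map_eq, uniformCube, ProbabilityTheory.cond, hv]

/-- Addition acts coordinatewise, so a pair of product vectors can be regrouped into a product of
pairs. This yields independence of the dither's coordinates. -/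
theorem map_toLp_pi_triangularLaw (d : ℕ) {η : ℝ} (hη : 0 < η) :
    (Measure.pi fun _ : Fin d => triangularLaw η).map (WithLp.toLp 2) = ditherLaw d η := by
  have := isProbabilityMeasure_uniformInterval hη
  have := isProbabilityMeasure_triangularLaw hη
  have hto : Measurable (WithLp.toLp 2 : (Fin d → ℝ) → EuclideanSpace ℝ (Fin d)) :=
    WithLp.measurable_toLp 2 _
  have h1 := (measurePreserving_arrowProdEquivProdArrow ℝ ℝ (Fin d)
    (fun _ => uniformInterval η) (fun _ => uniformInterval η)).map_eq
  have h2 : (Measure.pi fun _ : Fin d => triangularLaw η)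
      = (Measure.pi fun _ : Fin d => (uniformInterval η).prod (uniformInterval η)).map
        (fun x i => (x i).1 + (x i).2) := by
    have hs : ∀ _ : Fin d, SigmaFinite (((uniformInterval η).prod (uniformInterval η)).map
        (fun p : ℝ × ℝ => p.1 + p.2)) := fun _ => by
      change SigmaFinite (triangularLaw η); infer_instance
    rw [Measure.pi_map_pi (f := fun _ (p : ℝ × ℝ) => p.1 + p.2) (fun _ => by fun_prop)]
    rfl
  rw [ditherLaw, Measure.conv, ← map_toLp_pi_uniformInterval d η,
    Measure.map_prod_map _ _ hto hto, ← h1, h2, Measure.map_map hto (by fun_prop),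
    Measure.map_map (hto.prodMap hto) (MeasurableEquiv.measurable _),
    Measure.map_map (by fun_prop) ((hto.prodMap hto).comp (MeasurableEquiv.measurable _))]
  rfl

theorem isProbabilityMeasure_ditherLaw (d : ℕ) {η : ℝ} (hη : 0 < η) :
    IsProbabilityMeasure (ditherLaw d η) := by
  have := isProbabilityMeasure_triangularLaw hη
  rw [← map_toLp_pi_triangularLaw d hη]
  exact Measure.isProbabilityMeasure_map (WithLp.measurable_toLp 2 _).aemeasurable

theorem hasLaw_ofLp_ditherLaw (d : ℕ) {η : ℝ} (hη : 0 < η) :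
    HasLaw (fun (l : EuclideanSpace ℝ (Fin d)) i => l i)
      (Measure.pi fun _ : Fin d => triangularLaw η) (ditherLaw d η) where
  aemeasurable := by fun_prop
  map_eq := by
    rw [← map_toLp_pi_triangularLaw d hη,
      Measure.map_map (by fun_prop) (WithLp.measurable_toLp 2 _)]
    exact Measure.map_id

theorem hasLaw_apply_ditherLaw (d : ℕ) {η : ℝ} (hη : 0 < η) (j : Fin d) :
    HasLaw (fun l : EuclideanSpace ℝ (Fin d) => l j) (triangularLaw η) (ditherLaw d η) := by
  have := isProbabilityMeasure_triangularLaw hη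
  exact (measurePreserving_eval (fun _ : Fin d => triangularLaw η) j).hasLaw.comp
    (hasLaw_ofLp_ditherLaw d hη)

theorem iIndepFun_apply_ditherLaw (d : ℕ) {η : ℝ} (hη : 0 < η) :
    iIndepFun (fun (j : Fin d) (l : EuclideanSpace ℝ (Fin d)) => l j) (ditherLaw d η) := by
  have := isProbabilityMeasure_ditherLaw d hη
  exact (iIndepFun_iff_hasLaw_pi_pi (hasLaw_apply_ditherLaw d hη)).2 (hasLaw_ofLp_ditherLaw d hη)

end DitherLaw

/-! ### First and second moments of the scalar quantization error. -/

section ScalarQuantizer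

variable {η : ℝ}

@[fun_prop]
theorem measurable_quantize (η : ℝ) : Measurable (quantize η) := by
  unfold quantize
  have : Measurable fun t : ℝ => (⌊t / η⌋ : ℝ) :=
    (measurable_from_top (f := fun k : ℤ => (k : ℝ))).comp (measurable_id.div_const η).floor
  exact (this.add_const _).const_mul _

/-- The fractional part shows both the size of the rounding error and its periodicity. -/
theorem quantize_sub_self (hη : 0 < η) (t : ℝ) :
    quantize η t - t = η * (1 / 2 - Int.fract (t / η)) := by
  have h := Int.self_sub_floor (t / η)
  have : t = η * (t / η) := by field_simp
  rw [quantize, ← h]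
  linear_combination -this

theorem abs_quantize_sub_self_le (hη : 0 < η) (t : ℝ) : |quantize η t - t| ≤ η / 2 := by
  rw [quantize_sub_self hη, abs_mul, abs_of_pos hη]
  have : |1 / 2 - Int.fract (t / η)| ≤ 1 / 2 := by
    rw [abs_le]
    constructor <;> linarith [Int.fract_nonneg (t / η), Int.fract_lt_one (t / η)]
  nlinarith

theorem periodic_quantize_sub_self (hη : 0 < η) :
    Function.Periodic (fun t => quantize η t - t) η := by
  intro t
  simp only [quantize_sub_self hη, add_div, div_self hη.ne', Int.fract_add_one]

theorem ae_uniformInterval_abs_le (η : ℝ) : ∀ᵐ u ∂uniformInterval η, |u| ≤ η / 2 := by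
  filter_upwards [ae_cond_mem (μ := volume) (measurableSet_Icc (a := -(η / 2)) (b := η / 2))]
    with u hu
  exact abs_le.2 hu

theorem integral_uniformInterval (hη : 0 < η) (f : ℝ → ℝ) :
    ∫ u, f u ∂uniformInterval η = η⁻¹ * ∫ u in (-(η / 2))..(η / 2), f u := by
  rw [uniformInterval, ProbabilityTheory.cond, integral_smul_measure, volume_Icc_half,
    ENNReal.toReal_inv,
    ENNReal.toReal_ofReal hη.le, smul_eq_mul, intervalIntegral.integral_of_le (by linarith),
    integral_Icc_eq_integral_Ioc]

/-- A dither uniform over one period makes the quantization error uniform, for any input. -/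
theorem integral_comp_quantize_sub_self (hη : 0 < η) (F : ℝ → ℝ) (y : ℝ) :
    ∫ v, F (quantize η (y + v) - (y + v)) ∂uniformInterval η
      = η⁻¹ * ∫ t in (0 : ℝ)..η, F (η / 2 - t) := by
  have hper : Function.Periodic (fun t => F (quantize η t - t)) η :=
    fun t => congrArg F (periodic_quantize_sub_self hη t)
  have h1 : ∫ v in (-(η / 2))..(η / 2), F (quantize η (y + v) - (y + v))
      = ∫ t in (0 : ℝ)..η, F (quantize η t - t) := by
    rw [intervalIntegral.integral_comp_add_left (fun t => F (quantize η t - t)) y]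
    have := hper.intervalIntegral_add_eq (y + -(η / 2)) 0
    rw [zero_add] at this
    rw [← this]
    congr 1
    ring
  rw [integral_uniformInterval hη, h1]
  congr 1
  -- The interval must be open on the right: at `t = η` the fractional part drops back to `0`.
  rw [intervalIntegral.integral_of_le hη.le, intervalIntegral.integral_of_le hη.le,
    ← integral_Ico_eq_integral_Ioc, ← integral_Ico_eq_integral_Ioc]
  refine setIntegral_congr_fun measurableSet_Ico fun t ht => ?_
  have hf : Int.fract (t / η) = t / η :=
    Int.fract_eq_self.2 ⟨div_nonneg ht.1 hη.le, (div_lt_one hη).2 ht.2⟩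
  simp only [quantize_sub_self hη, hf]
  congr 1
  field_simp

theorem integral_quantize_sub_self (hη : 0 < η) (y : ℝ) :
    ∫ v, (quantize η (y + v) - (y + v)) ∂uniformInterval η = 0 := by
  rw [integral_comp_quantize_sub_self hη (fun z => z) y,
    intervalIntegral.integral_comp_sub_left (fun t => t), integral_id]
  ring

theorem integral_quantize_sub_self_sq (hη : 0 < η) (y : ℝ) :
    ∫ v, (quantize η (y + v) - (y + v)) ^ 2 ∂uniformInterval η = η ^ 2 / 12 := by
  rw [integral_comp_quantize_sub_self hη (fun z => z ^ 2) y]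
  have : ∫ t in (0 : ℝ)..η, (η / 2 - t) ^ 2 = η ^ 3 / 12 := by
    rw [intervalIntegral.integral_comp_sub_left (fun t => t ^ 2), integral_pow]
    norm_num
    ring
  rw [this]
  field_simp

theorem integral_uniformInterval_id (hη : 0 < η) : ∫ u, u ∂uniformInterval η = 0 := by
  rw [integral_uniformInterval hη]; simp

theorem integral_uniformInterval_sq (hη : 0 < η) : ∫ u, u ^ 2 ∂uniformInterval η = η ^ 2 / 12 := by
  rw [integral_uniformInterval hη, integral_pow]
  field_simp
  norm_num
  ring

theorem ae_triangularLaw_abs_le (hη : 0 < η) : ∀ᵐ s ∂triangularLaw η, |s| ≤ η := by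
  have := isProbabilityMeasure_uniformInterval hη
  rw [triangularLaw, Measure.conv,
    ae_map_iff (by fun_prop) (measurableSet_le (by fun_prop) (by fun_prop))]
  have h1 : ∀ᵐ p ∂(uniformInterval η).prod (uniformInterval η), |p.1| ≤ η / 2 :=
    Measure.quasiMeasurePreserving_fst.ae (ae_uniformInterval_abs_le η)
  have h2 : ∀ᵐ p ∂(uniformInterval η).prod (uniformInterval η), |p.2| ≤ η / 2 :=
    Measure.quasiMeasurePreserving_snd.ae (ae_uniformInterval_abs_le η)
  filter_upwards [h1, h2] with p h1 h2
  linarith [abs_add_le p.1 p.2]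

theorem abs_quantize_add_sub_le (hη : 0 < η) (x : ℝ) {s : ℝ} (hs : |s| ≤ η) :
    |quantize η (x + s) - x| ≤ 3 * η / 2 := by
  have h := abs_quantize_sub_self_le hη (x + s)
  have : quantize η (x + s) - x = (quantize η (x + s) - (x + s)) + s := by ring
  rw [this]
  linarith [abs_add_le (quantize η (x + s) - (x + s)) s]

theorem integrable_prod_uniformInterval (hη : 0 < η) {F : ℝ × ℝ → ℝ} (hm : Measurable F) (R : ℝ)
    (h : ∀ p : ℝ × ℝ, |p.1| ≤ η / 2 → |p.2| ≤ η / 2 → |F p| ≤ R) :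
    Integrable F ((uniformInterval η).prod (uniformInterval η)) := by
  have := isProbabilityMeasure_uniformInterval hη
  refine .of_bound hm.aestronglyMeasurable R ?_
  filter_upwards [Measure.quasiMeasurePreserving_fst.ae (ae_uniformInterval_abs_le η),
    Measure.quasiMeasurePreserving_snd.ae (ae_uniformInterval_abs_le η)] with p h1 h2
  exact h p h1 h2

/-- The total error is the rounding error plus the two uniform dithers; the rounding error already
averages to zero over one of them. -/
theorem integral_quantize_add_sub (hη : 0 < η) (x : ℝ) :
    ∫ s, (quantize η (x + s) - x) ∂triangularLaw η = 0 := by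
  have := isProbabilityMeasure_uniformInterval hη
  rw [triangularLaw, Measure.conv, integral_map (by fun_prop) (by
    exact Measurable.aestronglyMeasurable (by fun_prop))]
  have hi : Integrable (fun p : ℝ × ℝ => quantize η (x + (p.1 + p.2)) - (x + (p.1 + p.2)))
      ((uniformInterval η).prod (uniformInterval η)) :=
    integrable_prod_uniformInterval hη (by fun_prop) _ fun p _ _ => abs_quantize_sub_self_le hη _
  have hu : Integrable (fun p : ℝ × ℝ => p.1) ((uniformInterval η).prod (uniformInterval η)) :=
    integrable_prod_uniformInterval hη (by fun_prop) _ fun p h _ => h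
  have hv : Integrable (fun p : ℝ × ℝ => p.2) ((uniformInterval η).prod (uniformInterval η)) :=
    integrable_prod_uniformInterval hη (by fun_prop) _ fun p _ h => h
  calc _ = ∫ p : ℝ × ℝ, ((quantize η (x + (p.1 + p.2)) - (x + (p.1 + p.2))) + (p.1 + p.2))
        ∂(uniformInterval η).prod (uniformInterval η) := by
        congr 1; ext p; ring
    _ = 0 := by
      have huv : Integrable (fun p : ℝ × ℝ => p.1 + p.2)
        ((uniformInterval η).prod (uniformInterval η)) := hu.add hv
      rw [integral_add hi huv, integral_add hu hv, integral_prod _ hi, integral_prod _ hu,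
        integral_prod _ hv]
      simp only [← add_assoc, integral_quantize_sub_self hη, integral_uniformInterval_id hη,
        integral_const, smul_eq_mul]
      simp [integral_uniformInterval_id hη]

/-- The rounding error and the two uniform dithers are pairwise uncorrelated, each with variance `η²
/ 12`. For the rounding error against one dither, average over the other one first: this is why two
uniforms are summed. -/
theorem integral_quantize_add_sub_sq (hη : 0 < η) (x : ℝ) :
    ∫ s, (quantize η (x + s) - x) ^ 2 ∂triangularLaw η = η ^ 2 / 4 := by
  have := isProbabilityMeasure_uniformInterval hη
  rw [triangularLaw, Measure.conv, integral_map (by fun_prop) (by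
    exact Measurable.aestronglyMeasurable (by fun_prop))]
  set h : ℝ → ℝ := fun t => quantize η t - t with hh
  have hhm : Measurable h := by fun_prop
  have hb (t : ℝ) : |h t| ≤ η / 2 := abs_quantize_sub_self_le hη t
  have hsq {z : ℝ} (hz : |z| ≤ η / 2) : |z ^ 2| ≤ η / 2 * (η / 2) := by
    rw [pow_two, abs_mul]; gcongr
  have hmul {z w : ℝ} (hz : |z| ≤ η / 2) (hw : |w| ≤ η / 2) : |z * w| ≤ η / 2 * (η / 2) := by
    rw [abs_mul]; gcongr
  have i1 : Integrable (fun p : ℝ × ℝ => h (x + p.1 + p.2) ^ 2)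
      ((uniformInterval η).prod (uniformInterval η)) :=
    integrable_prod_uniformInterval hη (by fun_prop) _ fun p _ _ => hsq (hb _)
  have i2 : Integrable (fun p : ℝ × ℝ => p.1 ^ 2) ((uniformInterval η).prod (uniformInterval η)) :=
    integrable_prod_uniformInterval hη (by fun_prop) _ fun p h _ => hsq h
  have i3 : Integrable (fun p : ℝ × ℝ => p.2 ^ 2) ((uniformInterval η).prod (uniformInterval η)) :=
    integrable_prod_uniformInterval hη (by fun_prop) _ fun p _ h => hsq h
  have i4 : Integrable (fun p : ℝ × ℝ => p.1 * p.2)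
      ((uniformInterval η).prod (uniformInterval η)) :=
    integrable_prod_uniformInterval hη (by fun_prop) _ fun p h h' => hmul h h'
  have i5 : Integrable (fun p : ℝ × ℝ => p.1 * h (x + p.1 + p.2))
      ((uniformInterval η).prod (uniformInterval η)) :=
    integrable_prod_uniformInterval hη (by fun_prop) _ fun p h _ => hmul h (hb _)
  have i6 : Integrable (fun p : ℝ × ℝ => p.2 * h (x + p.1 + p.2))
      ((uniformInterval η).prod (uniformInterval η)) :=
    integrable_prod_uniformInterval hη (by fun_prop) _ fun p _ h => hmul h (hb _)
  have e0 (y : ℝ) : ∫ v, h (y + v) ∂uniformInterval η = 0 := integral_quantize_sub_self hη y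
  have e1 : ∫ p : ℝ × ℝ, h (x + p.1 + p.2) ^ 2 ∂(uniformInterval η).prod (uniformInterval η)
      = η ^ 2 / 12 := by
    rw [integral_prod _ i1]
    simp only [hh, integral_quantize_sub_self_sq hη]
    simp
  have e2 : ∫ p : ℝ × ℝ, p.1 ^ 2 ∂(uniformInterval η).prod (uniformInterval η) = η ^ 2 / 12 := by
    rw [integral_prod _ i2]
    simp [integral_uniformInterval_sq hη]
  have e3 : ∫ p : ℝ × ℝ, p.2 ^ 2 ∂(uniformInterval η).prod (uniformInterval η) = η ^ 2 / 12 := by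
    rw [integral_prod _ i3]
    simp [integral_uniformInterval_sq hη]
  have e4 : ∫ p : ℝ × ℝ, p.1 * p.2 ∂(uniformInterval η).prod (uniformInterval η) = 0 := by
    rw [integral_prod_mul (fun u : ℝ => u) (fun v : ℝ => v), integral_uniformInterval_id hη,
      mul_zero]
  have e5 : ∫ p : ℝ × ℝ, p.1 * h (x + p.1 + p.2) ∂(uniformInterval η).prod (uniformInterval η)
      = 0 := by
    rw [integral_prod _ i5]
    simp [integral_const_mul, e0]
  have e6 : ∫ p : ℝ × ℝ, p.2 * h (x + p.1 + p.2) ∂(uniformInterval η).prod (uniformInterval η)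
      = 0 := by
    rw [integral_prod_symm _ i6]
    have (v : ℝ) : ∫ u, h (x + u + v) ∂uniformInterval η = 0 := by
      simpa [add_right_comm] using e0 (x + v)
    simp [integral_const_mul, this]
  calc _ = ∫ p : ℝ × ℝ, ((h (x + p.1 + p.2) ^ 2 + p.1 ^ 2 + p.2 ^ 2) + 2 * (p.1 * p.2)
          + 2 * (p.1 * h (x + p.1 + p.2)) + 2 * (p.2 * h (x + p.1 + p.2)))
        ∂(uniformInterval η).prod (uniformInterval η) := by
        congr 1; ext p; simp only [hh, ← add_assoc]; ring
    _ = η ^ 2 / 4 := by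
      have a1 : Integrable (fun p : ℝ × ℝ => h (x + p.1 + p.2) ^ 2 + p.1 ^ 2)
        ((uniformInterval η).prod (uniformInterval η)) := i1.add i2
      have a2 : Integrable (fun p : ℝ × ℝ => h (x + p.1 + p.2) ^ 2 + p.1 ^ 2 + p.2 ^ 2)
        ((uniformInterval η).prod (uniformInterval η)) := a1.add i3
      have a3 : Integrable (fun p : ℝ × ℝ =>
          h (x + p.1 + p.2) ^ 2 + p.1 ^ 2 + p.2 ^ 2 + 2 * (p.1 * p.2))
        ((uniformInterval η).prod (uniformInterval η)) := a2.add (i4.const_mul 2)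
      have a4 : Integrable (fun p : ℝ × ℝ =>
          h (x + p.1 + p.2) ^ 2 + p.1 ^ 2 + p.2 ^ 2 + 2 * (p.1 * p.2)
            + 2 * (p.1 * h (x + p.1 + p.2)))
        ((uniformInterval η).prod (uniformInterval η)) := a3.add (i5.const_mul 2)
      rw [integral_add a4 (i6.const_mul 2), integral_add a3 (i5.const_mul 2),
        integral_add a2 (i4.const_mul 2), integral_add a1 i3, integral_add i1 i2]
      simp only [integral_const_mul, e1, e2, e3, e4, e5, e6]
      ring

end ScalarQuantizer

/-! ### Moments of the vector quantizer. -/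

section VectorQuantizer

variable {d : ℕ} {η : ℝ}

theorem ae_ditherLaw_abs_le (d : ℕ) (hη : 0 < η) : ∀ᵐ l ∂ditherLaw d η, ∀ j, |l j| ≤ η := by
  refine ae_all_iff.2 fun j => ?_
  have hm : Measurable fun s : ℝ => |s| ≤ η :=
    measurableSet_setOfPred.1 (measurableSet_le (by fun_prop) (by fun_prop))
  exact ((hasLaw_apply_ditherLaw d hη j).ae_iff (p := fun s => |s| ≤ η) hm).2
    (ae_triangularLaw_abs_le hη)

@[fun_prop]
theorem measurable_quantizeVec (η : ℝ) :
    Measurable (quantizeVec η : EuclideanSpace ℝ (Fin d) → EuclideanSpace ℝ (Fin d)) := by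
  unfold quantizeVec
  fun_prop

theorem norm_quantizeVec_add_sq_le (hη : 0 < η) (x : EuclideanSpace ℝ (Fin d))
    {l : EuclideanSpace ℝ (Fin d)} (hl : ∀ j, |l j| ≤ η) :
    ‖quantizeVec η (x + l)‖ ^ 2 ≤ 2 * ‖x‖ ^ 2 + 9 / 2 * d * η ^ 2 := by
  rw [EuclideanSpace.norm_sq_eq, EuclideanSpace.norm_sq_eq, Finset.mul_sum]
  have : (9 / 2 * d * η ^ 2 : ℝ) = ∑ _j : Fin d, 9 / 2 * η ^ 2 := by simp; ring
  rw [this, ← Finset.sum_add_distrib]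
  refine Finset.sum_le_sum fun j _ => ?_
  have h := abs_quantize_add_sub_le hη (x j) (hl j)
  simp only [quantizeVec, PiLp.add_apply, Real.norm_eq_abs, sq_abs]
  have h2 := sq_le_sq' (abs_le.1 h).1 (abs_le.1 h).2
  -- With error `e`, the hint is `(e - x j) ^ 2 ≥ 0`, that is `(x j + e) ^ 2 ≤ 2 * x j ^ 2 + 2 * e ^
  -- 2`.
  nlinarith [sq_nonneg (quantize η (x j + l j) - 2 * x j)]

theorem integrable_ditherLaw_of_abs_le (hη : 0 < η) {F : EuclideanSpace ℝ (Fin d) → ℝ}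
    (hm : Measurable F) (R : ℝ) (h : ∀ l : EuclideanSpace ℝ (Fin d), (∀ j, |l j| ≤ η) → |F l| ≤ R) :
    Integrable F (ditherLaw d η) := by
  have := isProbabilityMeasure_ditherLaw d hη
  exact .of_bound hm.aestronglyMeasurable R ((ae_ditherLaw_abs_le d hη).mono h)

/-- Expand around `x`: the linear error terms are centred, the mixed ones vanish by independence off
the diagonal and give `η² / 4` on it. -/
theorem integral_quantizeVec_mul (hη : 0 < η) (x : EuclideanSpace ℝ (Fin d)) (j k : Fin d) :
    ∫ l, quantizeVec η (x + l) j * quantizeVec η (x + l) k ∂ditherLaw d η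
      = x j * x k + η ^ 2 / 4 * (1 : Matrix (Fin d) (Fin d) ℝ) j k := by
  have := isProbabilityMeasure_ditherLaw d hη
  let e (i : Fin d) (s : ℝ) : ℝ := quantize η (x i + s) - x i
  have hem (i : Fin d) : Measurable (e i) := by fun_prop
  have hei (i : Fin d) : Measurable fun l : EuclideanSpace ℝ (Fin d) => e i (l i) := by fun_prop
  have heb (i : Fin d) (l : EuclideanSpace ℝ (Fin d)) (hl : ∀ j, |l j| ≤ η) :
      |e i (l i)| ≤ 3 * η / 2 := abs_quantize_add_sub_le hη (x i) (hl i)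
  have i1 (i : Fin d) : Integrable (fun l => e i (l i)) (ditherLaw d η) :=
    integrable_ditherLaw_of_abs_le hη (hei i) _ (heb i)
  have i2 : Integrable (fun l => e j (l j) * e k (l k)) (ditherLaw d η) :=
    integrable_ditherLaw_of_abs_le hη ((hei j).mul (hei k)) (3 * η / 2 * (3 * η / 2))
      fun l hl => by
        rw [abs_mul]
        have := heb j l hl
        have := heb k l hl
        gcongr
  have e0 (i : Fin d) : ∫ l, e i (l i) ∂ditherLaw d η = 0 := by
    have := (hasLaw_apply_ditherLaw d hη i).integral_comp (hem i).aestronglyMeasurable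
    exact this.trans (integral_quantize_add_sub hη (x i))
  have e1 : ∫ l, e j (l j) * e k (l k) ∂ditherLaw d η
      = η ^ 2 / 4 * (1 : Matrix (Fin d) (Fin d) ℝ) j k := by
    rcases eq_or_ne j k with rfl | hjk
    · have := (hasLaw_apply_ditherLaw d hη j).integral_comp
        (f := fun s => e j s ^ 2) ((hem j).pow_const 2).aestronglyMeasurable
      rw [integral_quantize_add_sub_sq hη] at this
      simpa [pow_two] using this
    · have hind := ((iIndepFun_apply_ditherLaw d hη).indepFun hjk).comp (hem j) (hem k)
      have := hind.integral_mul_eq_mul_integral (hei j).aestronglyMeasurable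
        (hei k).aestronglyMeasurable
      rw [Matrix.one_apply_ne hjk, mul_zero]
      refine this.trans ?_
      simp only [Function.comp_def, e0, mul_zero]
  have i3 : Integrable (fun l => x j * x k + x j * e k (l k)) (ditherLaw d η) :=
    (integrable_const _).add ((i1 k).const_mul _)
  have i4 : Integrable (fun l => x j * x k + x j * e k (l k) + x k * e j (l j)) (ditherLaw d η) :=
    i3.add ((i1 j).const_mul _)
  calc _ = ∫ l, (x j * x k + x j * e k (l k) + x k * e j (l j) + e j (l j) * e k (l k))
        ∂ditherLaw d η := by
        congr 1; ext l; simp only [quantizeVec, PiLp.add_apply, e]; ring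
    _ = _ := by
      rw [integral_add i4 i2, integral_add i3 ((i1 j).const_mul _),
        integral_add (integrable_const _) ((i1 k).const_mul _),
        integral_const_mul _ (fun l => e k _),
        integral_const_mul _ (fun l => e j _), e0, e0, e1]
      simp

theorem pow_four_le_exp_add_exp_neg (y : ℝ) : y ^ 4 ≤ 24 * (Real.exp y + Real.exp (-y)) := by
  have h := Real.pow_div_factorial_le_exp |y| (abs_nonneg y) 4
  have h4 : |y| ^ 4 = y ^ 4 := by rw [← abs_pow, abs_of_nonneg (by positivity)]
  rw [h4] at h
  norm_num [Nat.factorial] at h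
  rcases abs_choice y with h' | h' <;> rw [h'] at h <;>
    linarith [Real.exp_pos y, Real.exp_pos (-y)]

/-- At `±σ⁻¹` the moment generating function is at most `exp (1 / 2) ≤ 2`, and `96 = 24 * (2 + 2)`.
-/
theorem ProbabilityTheory.HasSubgaussianMGF.integral_pow_four_le {Ω : Type*} [MeasurableSpace Ω]
    {μ : Measure Ω} [IsProbabilityMeasure μ] {Z : Ω → ℝ} {c : NNReal} {σ : ℝ} (hσ : 0 < σ)
    (hc : (c : ℝ) = σ ^ 2) (h : HasSubgaussianMGF Z c μ) : ∫ ω, Z ω ^ 4 ∂μ ≤ 96 * σ ^ 4 := by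
  have hexp : Real.exp (1 / 2) ≤ 2 := by
    have h1 : Real.exp (1 / 2) ^ 2 = Real.exp 1 := by rw [← Real.exp_nat_mul]; norm_num
    nlinarith [Real.exp_one_lt_d9, Real.exp_pos (1 / 2)]
  have hm (t : ℝ) (ht : t ^ 2 = (σ ^ 2)⁻¹) : ∫ ω, Real.exp (t * Z ω) ∂μ ≤ 2 := by
    refine (h.mgf_le t).trans (le_trans (le_of_eq ?_) hexp)
    rw [hc, ht, mul_inv_cancel₀ (by positivity)]
  have i1 := h.integrable_exp_mul σ⁻¹
  have i2 := h.integrable_exp_mul (-σ⁻¹)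
  have h1 : ∫ ω, Z ω ^ 4 ∂μ
      ≤ ∫ ω, 24 * σ ^ 4 * (Real.exp (σ⁻¹ * Z ω) + Real.exp (-σ⁻¹ * Z ω)) ∂μ := by
    refine integral_mono_of_nonneg (.of_forall fun ω => by positivity)
      ((i1.add i2).const_mul _) (.of_forall fun ω => ?_)
    have := pow_four_le_exp_add_exp_neg (σ⁻¹ * Z ω)
    rw [mul_pow, inv_pow, ← neg_mul, inv_mul_le_iff₀ (by positivity)] at this
    simp only
    linarith
  rw [integral_const_mul, integral_add i1 i2] at h1
  have h2 := hm σ⁻¹ (by rw [inv_pow])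
  have h3 := hm (-σ⁻¹) (by rw [neg_sq, inv_pow])
  have h4 : 0 < σ ^ 4 := by positivity
  nlinarith

/-- By Hoeffding's lemma the error along `u` is a sum of independent sub-Gaussian terms; as `‖u‖ =
1`, its scale is `σ = 3η/2` in any dimension. Here `486 = 96 * (3 / 2) ^ 4`, and `8` comes from the
fourth power of a sum of two terms. -/
theorem integral_inner_quantizeVec_pow_four_le (hη : 0 < η) (x : EuclideanSpace ℝ (Fin d))
    {u : EuclideanSpace ℝ (Fin d)} (hu : ‖u‖ = 1) :
    ∫ l, ⟪quantizeVec η (x + l), u⟫ ^ 4 ∂ditherLaw d η ≤ 8 * (⟪x, u⟫ ^ 4 + 486 * η ^ 4) := by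
  have := isProbabilityMeasure_ditherLaw d hη
  let e (i : Fin d) (s : ℝ) : ℝ := quantize η (x i + s) - x i
  have hem (i : Fin d) : Measurable (e i) := by fun_prop
  have hei (i : Fin d) : Measurable fun l : EuclideanSpace ℝ (Fin d) => e i (l i) := by fun_prop
  have heb (i : Fin d) (l : EuclideanSpace ℝ (Fin d)) (hl : ∀ j, |l j| ≤ η) :
      |e i (l i)| ≤ 3 * η / 2 := abs_quantize_add_sub_le hη (x i) (hl i)
  have e0 (i : Fin d) : ∫ l, e i (l i) ∂ditherLaw d η = 0 := by
    have := (hasLaw_apply_ditherLaw d hη i).integral_comp (hem i).aestronglyMeasurable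
    exact this.trans (integral_quantize_add_sub hη (x i))
  have hsub (i : Fin d) : HasSubgaussianMGF (fun l : EuclideanSpace ℝ (Fin d) => u i * e i (l i))
      (Real.toNNReal (u i ^ 2 * (3 * η / 2) ^ 2)) (ditherLaw d η) := by
    have h := (hasSubgaussianMGF_of_mem_Icc_of_integral_eq_zero
      (a := -(3 * η / 2)) (b := 3 * η / 2) (hei i).aemeasurable
      ((ae_ditherLaw_abs_le d hη).mono fun l hl => abs_le.1 (heb i l hl)) (e0 i)).const_mul (u i)
    convert h using 1
    apply NNReal.eq
    rw [Real.coe_toNNReal _ (by positivity)]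
    change _ = u i ^ 2 * (‖3 * η / 2 - -(3 * η / 2)‖ / 2) ^ 2
    rw [Real.norm_of_nonneg (by linarith)]
    ring
  have hind : iIndepFun (fun i (l : EuclideanSpace ℝ (Fin d)) => u i * e i (l i)) (ditherLaw d η) :=
    (iIndepFun_apply_ditherLaw d hη).comp (fun i s => u i * e i s) fun i => (hem i).const_mul _
  have hZ := HasSubgaussianMGF.sum_of_iIndepFun hind (s := Finset.univ) fun i _ => hsub i
  have hu2 : ∑ i, u i ^ 2 = 1 := by
    have := EuclideanSpace.real_norm_sq_eq u
    rw [hu] at this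
    linarith
  have h4 := hZ.integral_pow_four_le (σ := 3 * η / 2) (by positivity) (by
    rw [NNReal.coe_sum, Finset.sum_congr rfl fun i _ => Real.coe_toNNReal _ (by positivity),
      ← Finset.sum_mul, hu2, one_mul])
  have hZi : Integrable (fun l : EuclideanSpace ℝ (Fin d) => (∑ i, u i * e i (l i)) ^ 4)
      (ditherLaw d η) := by
    have h := (hZ.memLp 4).integrable_norm_pow (by norm_num)
    refine h.congr (.of_forall fun l => ?_)
    exact (even_two_mul 2).pow_abs _
  have hdec (l : EuclideanSpace ℝ (Fin d)) :
      ⟪quantizeVec η (x + l), u⟫ = ⟪x, u⟫ + ∑ i, u i * e i (l i) := by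
    simp only [PiLp.inner_apply, ← Finset.sum_add_distrib, quantizeVec, PiLp.add_apply, e]
    refine Finset.sum_congr rfl fun i _ => ?_
    simp only [RCLike.inner_apply, conj_trivial]
    ring
  calc ∫ l, ⟪quantizeVec η (x + l), u⟫ ^ 4 ∂ditherLaw d η
      ≤ ∫ l, (8 * ⟪x, u⟫ ^ 4 + 8 * (∑ i, u i * e i (l i)) ^ 4) ∂ditherLaw d η := by
        refine integral_mono_of_nonneg (.of_forall fun l => by positivity)
          ((integrable_const _).add (hZi.const_mul 8)) (.of_forall fun l => ?_)
        simp only [hdec]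
        have h (a b : ℝ) : (a + b) ^ 4 ≤ 8 * a ^ 4 + 8 * b ^ 4 := by
          have h1 : (a + b) ^ 2 ≤ 2 * (a ^ 2 + b ^ 2) := by nlinarith [sq_nonneg (a - b)]
          have h2 : ((a + b) ^ 2) ^ 2 ≤ (2 * (a ^ 2 + b ^ 2)) ^ 2 :=
            pow_le_pow_left₀ (sq_nonneg _) h1 2
          nlinarith [sq_nonneg (a ^ 2 - b ^ 2)]
        exact h _ _
    _ ≤ 8 * (⟪x, u⟫ ^ 4 + 486 * η ^ 4) := by
        rw [integral_add (integrable_const _) (hZi.const_mul 8),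
          integral_const_mul 8 (fun l : EuclideanSpace ℝ (Fin d) => (∑ i, u i * e i (l i)) ^ 4)]
        simp only [integral_const, probReal_univ, one_smul]
        linarith

end VectorQuantizer

/-! ### From directional to mixed fourth moments. -/

section FourthMoments

variable {d : ℕ} {α : Type*} [MeasurableSpace α] {μ : Measure α}

theorem integrable_sq_mul_sq {f g : α → ℝ} (hf : AEStronglyMeasurable f μ)
    (hg : AEStronglyMeasurable g μ) (hf4 : Integrable (fun a => f a ^ 4) μ)
    (hg4 : Integrable (fun a => g a ^ 4) μ) : Integrable (fun a => f a ^ 2 * g a ^ 2) μ := by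
  refine ((hf4.add hg4).const_mul (1 / 2)).mono' ((hf.pow 2).mul (hg.pow 2))
    (.of_forall fun a => ?_)
  rw [Real.norm_of_nonneg (by positivity)]
  simp only [Pi.add_apply]
  nlinarith [sq_nonneg (f a ^ 2 - g a ^ 2)]

theorem integral_sq_mul_sq_le {f g : α → ℝ} {K : ℝ} (hf4 : Integrable (fun a => f a ^ 4) μ)
    (hg4 : Integrable (fun a => g a ^ 4) μ) (hfK : ∫ a, f a ^ 4 ∂μ ≤ K)
    (hgK : ∫ a, g a ^ 4 ∂μ ≤ K) : ∫ a, f a ^ 2 * g a ^ 2 ∂μ ≤ K := by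
  have h : ∫ a, f a ^ 2 * g a ^ 2 ∂μ ≤ ∫ a, 1 / 2 * (f a ^ 4 + g a ^ 4) ∂μ := by
    refine integral_mono_of_nonneg (.of_forall fun a => by positivity)
      ((hf4.add hg4).const_mul (1 / 2)) (.of_forall fun a => ?_)
    simp only
    nlinarith [sq_nonneg (f a ^ 2 - g a ^ 2)]
  rw [integral_const_mul, integral_add hf4 hg4] at h
  linarith

theorem norm_sq_eq_sum_inner_single (y : EuclideanSpace ℝ (Fin d)) :
    ‖y‖ ^ 2 = ∑ j, ⟪y, EuclideanSpace.single j (1 : ℝ)⟫ ^ 2 := by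
  rw [EuclideanSpace.real_norm_sq_eq]
  simp [EuclideanSpace.inner_single_right]

theorem integrable_norm_sq_mul_inner_sq {Y : α → EuclideanSpace ℝ (Fin d)}
    (hY : AEStronglyMeasurable Y μ)
    (hi : ∀ u : EuclideanSpace ℝ (Fin d), ‖u‖ = 1 → Integrable (fun a => ⟪Y a, u⟫ ^ 4) μ)
    {u : EuclideanSpace ℝ (Fin d)} (hu : ‖u‖ = 1) :
    Integrable (fun a => ‖Y a‖ ^ 2 * ⟪Y a, u⟫ ^ 2) μ := by
  simp only [norm_sq_eq_sum_inner_single, Finset.sum_mul]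
  exact integrable_finsetSum _ fun j _ => integrable_sq_mul_sq (hY.inner_const) (hY.inner_const)
    (hi _ (by simp)) (hi u hu)

/-- Expand `‖Y‖ ^ 2` over the basis; each of the `d` mixed moments is at most `K`. This serves both
the variance (quantized data) and the bias (raw data). -/
theorem integral_norm_sq_mul_inner_sq_le_of_norm_eq_one {Y : α → EuclideanSpace ℝ (Fin d)} {K : ℝ}
    (hY : AEStronglyMeasurable Y μ)
    (hi : ∀ u : EuclideanSpace ℝ (Fin d), ‖u‖ = 1 → Integrable (fun a => ⟪Y a, u⟫ ^ 4) μ)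
    (hK : ∀ u : EuclideanSpace ℝ (Fin d), ‖u‖ = 1 → ∫ a, ⟪Y a, u⟫ ^ 4 ∂μ ≤ K)
    {u : EuclideanSpace ℝ (Fin d)} (hu : ‖u‖ = 1) :
    ∫ a, ‖Y a‖ ^ 2 * ⟪Y a, u⟫ ^ 2 ∂μ ≤ d * K := by
  have he (j : Fin d) : ‖EuclideanSpace.single j (1 : ℝ)‖ = 1 := by simp
  simp only [norm_sq_eq_sum_inner_single, Finset.sum_mul]
  rw [integral_finsetSum _ fun j _ => integrable_sq_mul_sq (hY.inner_const) (hY.inner_const)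
    (hi _ (he j)) (hi u hu)]
  refine (Finset.sum_le_sum fun j _ => integral_sq_mul_sq_le (hi _ (he j)) (hi u hu)
    (hK _ (he j)) (hK u hu)).trans (le_of_eq ?_)
  simp

theorem integral_norm_sq_mul_inner_sq_le {Y : α → EuclideanSpace ℝ (Fin d)} {K : ℝ}
    (hY : AEStronglyMeasurable Y μ)
    (hi : ∀ u : EuclideanSpace ℝ (Fin d), ‖u‖ = 1 → Integrable (fun a => ⟪Y a, u⟫ ^ 4) μ)
    (hK : ∀ u : EuclideanSpace ℝ (Fin d), ‖u‖ = 1 → ∫ a, ⟪Y a, u⟫ ^ 4 ∂μ ≤ K)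
    (u : EuclideanSpace ℝ (Fin d)) :
    ∫ a, ‖Y a‖ ^ 2 * ⟪Y a, u⟫ ^ 2 ∂μ ≤ d * K * ‖u‖ ^ 2 := by
  rcases eq_or_ne u 0 with rfl | hu
  · simp
  have hn : ‖u‖ ≠ 0 := norm_ne_zero_iff.2 hu
  have h := integral_norm_sq_mul_inner_sq_le_of_norm_eq_one hY hi hK (u := ‖u‖⁻¹ • u)
    (by rw [norm_smul, norm_inv, norm_norm, inv_mul_cancel₀ hn])
  have e (a : α) : ‖Y a‖ ^ 2 * ⟪Y a, u⟫ ^ 2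
      = ‖u‖ ^ 2 * (‖Y a‖ ^ 2 * ⟪Y a, ‖u‖⁻¹ • u⟫ ^ 2) := by
    rw [real_inner_smul_right]; field_simp
  simp only [e]
  rw [integral_const_mul]
  nlinarith [sq_nonneg ‖u‖]

end FourthMoments

/-! ### Outer products and the spectral norm. -/

section OuterProduct
open Matrix
open scoped Matrix.Norms.L2Operator

variable {d : ℕ}

theorem dotProduct_ofLp_eq_inner (x y : EuclideanSpace ℝ (Fin d)) : x.ofLp ⬝ᵥ y.ofLp = ⟪x, y⟫ := by
  simp [PiLp.inner_apply, dotProduct, mul_comm]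

theorem Matrix.norm_vecMulVec_self_le (x : EuclideanSpace ℝ (Fin d)) :
    ‖vecMulVec x.ofLp x.ofLp‖ ≤ ‖x‖ ^ 2 := by
  rw [cstar_norm_def]
  refine ContinuousLinearMap.opNorm_le_bound _ (by positivity) fun y => ?_
  have : toEuclideanCLM (n := Fin d) (𝕜 := ℝ) (vecMulVec x.ofLp x.ofLp) y = ⟪x, y⟫ • x := by
    ext j
    rw [ofLp_toEuclideanCLM, vecMulVec_mulVec, dotProduct_ofLp_eq_inner]
    simp [mul_comm]
  rw [this, norm_smul, Real.norm_eq_abs]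
  nlinarith [abs_real_inner_le_norm x y, norm_nonneg x]

theorem Matrix.dotProduct_vecMulVec_self_mulVec (x u : EuclideanSpace ℝ (Fin d)) :
    u.ofLp ⬝ᵥ vecMulVec x.ofLp x.ofLp *ᵥ u.ofLp = ⟪x, u⟫ ^ 2 := by
  rw [vecMulVec_mulVec, dotProduct_ofLp_eq_inner]
  simp [dotProduct_ofLp_eq_inner, real_inner_smul_right, pow_two, real_inner_comm x u]

theorem Matrix.vecMulVec_self_mul_self (x : EuclideanSpace ℝ (Fin d)) :
    vecMulVec x.ofLp x.ofLp * vecMulVec x.ofLp x.ofLp = ‖x‖ ^ 2 • vecMulVec x.ofLp x.ofLp := by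
  rw [vecMulVec_mul_vecMulVec, dotProduct_ofLp_eq_inner, real_inner_self_eq_norm_sq]
  ext i j
  simp [vecMulVec_apply]
  ring

theorem Matrix.isHermitian_vecMulVec_self (v : Fin d → ℝ) : (vecMulVec v v).IsHermitian := by
  ext i j
  simp [vecMulVec_apply, mul_comm]

theorem Matrix.IsHermitian.norm_le_of_abs_dotProduct_le {A : Matrix (Fin d) (Fin d) ℝ}
    (hA : A.IsHermitian) {c : ℝ} (hc : 0 ≤ c)
    (h : ∀ u : EuclideanSpace ℝ (Fin d), ‖u‖ = 1 → |u.ofLp ⬝ᵥ A *ᵥ u.ofLp| ≤ c) : ‖A‖ ≤ c := by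
  obtain ⟨U, l, rfl⟩ := hA.exists_diagonalization
  have hU : (U : Matrix (Fin d) (Fin d) ℝ)ᴴ * (U : Matrix (Fin d) (Fin d) ℝ) = 1 :=
    Unitary.coe_star_mul_self U
  rw [norm_unitary_conj, l2_opNorm_diagonal, pi_norm_le_iff_of_nonneg hc]
  intro i
  -- The unit eigenvector for `l i`; its quadratic form returns the eigenvalue.
  let u : EuclideanSpace ℝ (Fin d) :=
    WithLp.toLp 2 ((U : Matrix (Fin d) (Fin d) ℝ) *ᵥ Pi.single i 1)
  have hstar (B : Matrix (Fin d) (Fin d) ℝ) (v w : Fin d → ℝ) : (B *ᵥ v) ⬝ᵥ w = v ⬝ᵥ Bᴴ *ᵥ w := by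
    rw [conjTranspose_eq_transpose_of_trivial, mulVec_transpose, dotProduct_comm,
      dotProduct_mulVec, dotProduct_comm]
  have hu : ‖u‖ = 1 := by
    rw [← sq_eq_sq₀ (norm_nonneg _) zero_le_one, ← real_inner_self_eq_norm_sq,
      ← dotProduct_ofLp_eq_inner]
    simp only [u]
    rw [hstar, mulVec_mulVec, hU, one_mulVec]
    simp
  have h1 := h u hu
  have h2 : u.ofLp ⬝ᵥ ((U : Matrix (Fin d) (Fin d) ℝ) * diagonal l
      * (U : Matrix (Fin d) (Fin d) ℝ)ᴴ) *ᵥ u.ofLp = l i := by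
    simp only [u]
    rw [hstar, mulVec_mulVec, mulVec_mulVec]
    have : (U : Matrix (Fin d) (Fin d) ℝ)ᴴ * ((U : Matrix (Fin d) (Fin d) ℝ) * diagonal l
      * (U : Matrix (Fin d) (Fin d) ℝ)ᴴ * (U : Matrix (Fin d) (Fin d) ℝ)) = diagonal l := by
      rw [mul_assoc _ _ (U : Matrix (Fin d) (Fin d) ℝ), hU, mul_one, ← mul_assoc, hU, one_mul]
    simp only [mul_assoc] at this ⊢
    rw [this]
    simp
  rwa [h2] at h1

end OuterProduct

/-! ### Shrinkage. -/

section Shrink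

variable {d : ℕ} {τ : ℝ}

@[fun_prop]
theorem measurable_shrink (τ : ℝ) :
    Measurable (shrink τ : EuclideanSpace ℝ (Fin d) → EuclideanSpace ℝ (Fin d)) := by
  unfold shrink
  fun_prop

theorem norm_shrink_le (hτ : 0 ≤ τ) (x : EuclideanSpace ℝ (Fin d)) : ‖shrink τ x‖ ≤ τ := by
  rw [shrink, norm_smul, Real.norm_of_nonneg (by positivity)]
  rcases eq_or_ne ‖x‖ 0 with h | h
  · simpa [h] using hτ
  · rw [div_mul_cancel₀ _ h]; exact min_le_right _ _

theorem inner_shrink_sq_le (hτ : 0 ≤ τ) (x u : EuclideanSpace ℝ (Fin d)) :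
    ⟪shrink τ x, u⟫ ^ 2 ≤ ⟪x, u⟫ ^ 2 := by
  rw [shrink, real_inner_smul_left, mul_pow]
  have h0 : 0 ≤ min ‖x‖ τ / ‖x‖ := by positivity
  have h1 : min ‖x‖ τ / ‖x‖ ≤ 1 := div_le_one_of_le₀ (min_le_left _ _) (norm_nonneg _)
  exact mul_le_of_le_one_left (sq_nonneg _) (pow_le_one₀ h0 h1)

/-- Nothing is lost unless `‖x‖ > τ`, and there `1 ≤ ‖x‖ ^ 2 / τ ^ 2`. -/
theorem inner_sq_sub_inner_shrink_sq_le (hτ : 0 < τ) (x u : EuclideanSpace ℝ (Fin d)) :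
    ⟪x, u⟫ ^ 2 - ⟪shrink τ x, u⟫ ^ 2 ≤ (τ ^ 2)⁻¹ * (‖x‖ ^ 2 * ⟪x, u⟫ ^ 2) := by
  rcases le_or_gt ‖x‖ τ with h | h
  · have : shrink τ x = x := by
      rcases eq_or_ne x 0 with rfl | hx
      · simp [shrink]
      · rw [shrink, min_eq_left h, div_self (norm_ne_zero_iff.2 hx), one_smul]
    rw [this, sub_self]
    positivity
  · have h1 : 1 ≤ (τ ^ 2)⁻¹ * ‖x‖ ^ 2 := by
      rw [inv_mul_eq_div, one_le_div (by positivity)]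
      exact pow_le_pow_left₀ hτ.le h.le 2
    nlinarith [sq_nonneg ⟪shrink τ x, u⟫, sq_nonneg ⟪x, u⟫]

end Shrink

/-! ### Mean, variance and bias of the quantized outer products. -/

section QuantizedMoments
open Matrix
open scoped Matrix.Norms.L2Operator

variable {d : ℕ} {τ η M : ℝ} {ν : Measure (EuclideanSpace ℝ (Fin d))}

@[fun_prop]
theorem Matrix.measurable_vecMulVec_self :
    Measurable fun x : EuclideanSpace ℝ (Fin d) => vecMulVec x.ofLp x.ofLp := by
  have h : Measurable fun (x : EuclideanSpace ℝ (Fin d)) (i j : Fin d) => x i * x j := by fun_prop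
  exact h

theorem measurable_quantizedSample (τ η : ℝ) :
    Measurable fun p : EuclideanSpace ℝ (Fin d) × EuclideanSpace ℝ (Fin d) =>
      quantizedSample τ η p.1 p.2 := by
  unfold quantizedSample
  fun_prop

theorem ae_norm_quantizedSample_sq_le (hη : 0 < η) (hτ : 0 ≤ τ) [SFinite ν] :
    ∀ᵐ p ∂ν.prod (ditherLaw d η),
      ‖quantizedSample τ η p.1 p.2‖ ^ 2 ≤ 2 * τ ^ 2 + 9 / 2 * d * η ^ 2 := by
  have := isProbabilityMeasure_ditherLaw d hη
  filter_upwards [Measure.quasiMeasurePreserving_snd.ae (ae_ditherLaw_abs_le d hη)] with p hp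
  have h1 := norm_quantizeVec_add_sq_le hη (shrink τ p.1) hp
  have h2 := pow_le_pow_left₀ (norm_nonneg _) (norm_shrink_le hτ p.1) 2
  rw [quantizedSample]
  linarith

variable [IsProbabilityMeasure ν]

theorem integrable_quantizedSample_of_abs_le (hη : 0 < η) (hτ : 0 ≤ τ)
    {F : EuclideanSpace ℝ (Fin d) → ℝ} (hF : Measurable F) (φ : ℝ → ℝ) (hφ : Monotone φ)
    (h : ∀ y, |F y| ≤ φ (‖y‖ ^ 2)) :
    Integrable (fun p => F (quantizedSample τ η p.1 p.2)) (ν.prod (ditherLaw d η)) := by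
  have := isProbabilityMeasure_ditherLaw d hη
  refine .of_bound (hF.comp (measurable_quantizedSample τ η)).aestronglyMeasurable
    (φ (2 * τ ^ 2 + 9 / 2 * d * η ^ 2)) ?_
  filter_upwards [ae_norm_quantizedSample_sq_le hη hτ] with p hp
  exact (h _).trans (hφ hp)

theorem integrable_quantizedSample_mul (hη : 0 < η) (hτ : 0 ≤ τ) (j k : Fin d) :
    Integrable (fun p => quantizedSample τ η p.1 p.2 j * quantizedSample τ η p.1 p.2 k)
      (ν.prod (ditherLaw d η)) := by
  refine integrable_quantizedSample_of_abs_le hη hτ (F := fun y => y j * y k) (by fun_prop) id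
    monotone_id fun y => ?_
  rw [abs_mul, id, pow_two]
  have h1 := PiLp.norm_apply_le y j
  have h2 := PiLp.norm_apply_le y k
  rw [Real.norm_eq_abs] at h1 h2
  gcongr

theorem integrable_inner_quantizedSample_pow_four (hη : 0 < η) (hτ : 0 ≤ τ)
    {u : EuclideanSpace ℝ (Fin d)} (hu : ‖u‖ = 1) :
    Integrable (fun p => ⟪quantizedSample τ η p.1 p.2, u⟫ ^ 4) (ν.prod (ditherLaw d η)) := by
  -- The `max` makes the square monotone on all of `ℝ`.
  refine integrable_quantizedSample_of_abs_le hη hτ (F := fun y => ⟪y, u⟫ ^ 4) (by fun_prop)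
    (fun t => (max t 0) ^ 2) (fun s t h => by dsimp only; gcongr) fun y => ?_
  have h := abs_real_inner_le_norm y u
  rw [hu, mul_one] at h
  rw [abs_pow, max_eq_left (sq_nonneg _), ← pow_mul]
  gcongr

theorem integral_vecMulVec_quantizedSample (hη : 0 < η) (hτ : 0 ≤ τ) :
    ∫ p, vecMulVec (quantizedSample τ η p.1 p.2).ofLp (quantizedSample τ η p.1 p.2).ofLp
        ∂ν.prod (ditherLaw d η)
      = ∫ x, vecMulVec (shrink τ x).ofLp (shrink τ x).ofLp ∂ν
        + (η ^ 2 / 4) • (1 : Matrix (Fin d) (Fin d) ℝ) := by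
  have := isProbabilityMeasure_ditherLaw d hη
  have hsm (j k : Fin d) : Integrable (fun x => shrink τ x j * shrink τ x k) ν := by
    refine .of_bound (Measurable.aestronglyMeasurable (by fun_prop)) (τ * τ)
      (.of_forall fun x => ?_)
    have h1 := (PiLp.norm_apply_le (shrink τ x) j).trans (norm_shrink_le hτ x)
    have h2 := (PiLp.norm_apply_le (shrink τ x) k).trans (norm_shrink_le hτ x)
    rw [norm_mul]
    gcongr
  have iW : Integrable (fun p => vecMulVec (quantizedSample τ η p.1 p.2).ofLp
      (quantizedSample τ η p.1 p.2).ofLp) (ν.prod (ditherLaw d η)) :=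
    integrable_of_apply fun j k => integrable_quantizedSample_mul hη hτ j k
  have is : Integrable (fun x => vecMulVec (shrink τ x).ofLp (shrink τ x).ofLp) ν :=
    integrable_of_apply fun j k => hsm j k
  ext j k
  rw [Matrix.integral_apply iW, Matrix.add_apply, Matrix.integral_apply is]
  simp only [vecMulVec_apply]
  rw [integral_prod _ (integrable_quantizedSample_mul hη hτ j k)]
  simp only [quantizedSample, integral_quantizeVec_mul hη]
  rw [integral_add (hsm j k) (integrable_const _)]
  simp

theorem integral_inner_quantizedSample_pow_four_le (hη : 0 < η) (hτ : 0 ≤ τ)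
    {u : EuclideanSpace ℝ (Fin d)} (hu : ‖u‖ = 1) (hi : Integrable (fun x => ⟪x, u⟫ ^ 4) ν)
    (hM : ∫ x, ⟪x, u⟫ ^ 4 ∂ν ≤ M) :
    ∫ p, ⟪quantizedSample τ η p.1 p.2, u⟫ ^ 4 ∂ν.prod (ditherLaw d η)
      ≤ 8 * (M + 486 * η ^ 4) := by
  have := isProbabilityMeasure_ditherLaw d hη
  rw [integral_prod _ (integrable_inner_quantizedSample_pow_four hη hτ hu)]
  have h : ∫ x, ∫ l, ⟪quantizedSample τ η x l, u⟫ ^ 4 ∂ditherLaw d η ∂ν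
      ≤ ∫ x, 8 * (⟪x, u⟫ ^ 4 + 486 * η ^ 4) ∂ν := by
    refine integral_mono_of_nonneg (.of_forall fun x => integral_nonneg fun l => by positivity)
      ((hi.add (integrable_const _)).const_mul 8) (.of_forall fun x => ?_)
    refine (integral_inner_quantizeVec_pow_four_le hη (shrink τ x) hu).trans ?_
    have := pow_le_pow_left₀ (sq_nonneg _) (inner_shrink_sq_le hτ x u) 2
    simp only
    nlinarith
  rw [integral_const_mul, integral_add hi (integrable_const _)] at h
  refine h.trans ?_
  simp only [integral_const, probReal_univ, one_smul]
  linarith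

theorem norm_integral_vecMulVec_quantizedSample_le (hη : 0 < η) (hτ : 0 ≤ τ) :
    ‖∫ p, vecMulVec (quantizedSample τ η p.1 p.2).ofLp (quantizedSample τ η p.1 p.2).ofLp
        ∂ν.prod (ditherLaw d η)‖ ≤ 2 * τ ^ 2 + 9 / 2 * d * η ^ 2 := by
  have := isProbabilityMeasure_ditherLaw d hη
  have h := norm_integral_le_of_norm_le_const (μ := ν.prod (ditherLaw d η))
    ((ae_norm_quantizedSample_sq_le (τ := τ) (ν := ν) hη hτ).mono fun p hp =>
      (norm_vecMulVec_self_le (quantizedSample τ η p.1 p.2)).trans hp)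
  simpa using h

/-- Centring only subtracts `m * m ⪰ 0`, and `W * W = ‖q‖ ^ 2 • W` for the outer product `W` of the
sample `q`, so its quadratic form is the mixed fourth moment of `q`. -/
theorem posSemidef_sub_integral_centered_sq (hη : 0 < η) (hτ : 0 ≤ τ)
    (hi : ∀ u : EuclideanSpace ℝ (Fin d), ‖u‖ = 1 → Integrable (fun x => ⟪x, u⟫ ^ 4) ν)
    (hM : ∀ u : EuclideanSpace ℝ (Fin d), ‖u‖ = 1 → ∫ x, ⟪x, u⟫ ^ 4 ∂ν ≤ M)
    {m : Matrix (Fin d) (Fin d) ℝ}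
    (hm : m = ∫ p, vecMulVec (quantizedSample τ η p.1 p.2).ofLp (quantizedSample τ η p.1 p.2).ofLp
      ∂ν.prod (ditherLaw d η)) :
    ((d * (8 * (M + 486 * η ^ 4))) • (1 : Matrix (Fin d) (Fin d) ℝ) - ∫ p,
      (vecMulVec (quantizedSample τ η p.1 p.2).ofLp (quantizedSample τ η p.1 p.2).ofLp - m)
      * (vecMulVec (quantizedSample τ η p.1 p.2).ofLp (quantizedSample τ η p.1 p.2).ofLp - m)
        ∂ν.prod (ditherLaw d η)).PosSemidef := by
  have := isProbabilityMeasure_ditherLaw d hη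
  set ρ := ν.prod (ditherLaw d η)
  set W := fun p : EuclideanSpace ℝ (Fin d) × EuclideanSpace ℝ (Fin d) =>
    vecMulVec (quantizedSample τ η p.1 p.2).ofLp (quantizedSample τ η p.1 p.2).ofLp with hW
  have iW : Integrable W ρ :=
    integrable_of_apply fun j k => integrable_quantizedSample_mul hη hτ j k
  have hWW (p) : W p * W p = ‖quantizedSample τ η p.1 p.2‖ ^ 2 • W p := vecMulVec_self_mul_self _
  have iWW : Integrable (fun p => W p * W p) ρ := by
    simp only [hWW]
    refine iW.bdd_smul (2 * τ ^ 2 + 9 / 2 * d * η ^ 2)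
      ((measurable_quantizedSample τ η).norm.pow_const 2).aestronglyMeasurable ?_
    filter_upwards [ae_norm_quantizedSample_sq_le (τ := τ) (ν := ν) hη hτ] with p hp
    rwa [Real.norm_of_nonneg (by positivity)]
  have iWm : Integrable (fun p => W p * m) ρ := iW.mul_const m
  have imW : Integrable (fun p => m * W p) ρ := iW.const_mul m
  have hmH : m.IsHermitian := by
    rw [hm]
    exact isHermitian_integral iW (.of_forall fun p => isHermitian_vecMulVec_self _)
  have hexp : ∫ p, (W p - m) * (W p - m) ∂ρ = ∫ p, W p * W p ∂ρ - m * m := by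
    have h1 : Integrable (fun p => W p * W p - W p * m) ρ := iWW.sub iWm
    have h2 : Integrable (fun p => W p * W p - W p * m - m * W p) ρ := h1.sub imW
    calc _ = ∫ p, (W p * W p - W p * m - m * W p + m * m) ∂ρ := by
          congr 1; ext1 p; noncomm_ring
      _ = _ := by
          rw [integral_add h2 (integrable_const _), integral_sub h1 imW, integral_sub iWW iWm,
            integral_mul_const_of_integrable iW, integral_const_mul_of_integrable iW, ← hm]
          simp
  have hpsd : ((d * (8 * (M + 486 * η ^ 4))) • (1 : Matrix (Fin d) (Fin d) ℝ)
      - ∫ p, W p * W p ∂ρ).PosSemidef := by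
    refine PosSemidef.of_dotProduct_mulVec_nonneg (IsHermitian.sub ?_ ?_) fun v => ?_
    · exact isHermitian_one.smul (.all _)
    · refine isHermitian_integral iWW (.of_forall fun p => ?_)
      rw [hWW]
      exact (isHermitian_vecMulVec_self _).smul (.all _)
    · have h := integral_norm_sq_mul_inner_sq_le (μ := ρ)
        (measurable_quantizedSample τ η).aestronglyMeasurable
        (fun u hu => integrable_inner_quantizedSample_pow_four hη hτ hu)
        (fun u hu => integral_inner_quantizedSample_pow_four_le hη hτ hu (hi u hu) (hM u hu))
        (WithLp.toLp 2 v)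
      rw [star_trivial, sub_mulVec, dotProduct_sub, integral_dotProduct_mulVec iWW, smul_mulVec,
        one_mulVec, dotProduct_smul, smul_eq_mul]
      have e1 : v ⬝ᵥ v = ‖(WithLp.toLp 2 v : EuclideanSpace ℝ (Fin d))‖ ^ 2 := by
        rw [← real_inner_self_eq_norm_sq, ← dotProduct_ofLp_eq_inner]
      have e2 (p) : v ⬝ᵥ (W p * W p) *ᵥ v = ‖quantizedSample τ η p.1 p.2‖ ^ 2
          * ⟪quantizedSample τ η p.1 p.2, (WithLp.toLp 2 v : EuclideanSpace ℝ (Fin d))⟫ ^ 2 := by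
        rw [hWW, smul_mulVec, dotProduct_smul, smul_eq_mul]
        congr 1
        exact dotProduct_vecMulVec_self_mulVec _ (WithLp.toLp 2 v)
      simp only [e1, e2]
      linarith
  rw [hexp]
  have h2 := hpsd.add (posSemidef_self_mul_conjTranspose m)
  rw [hmH.eq] at h2
  convert h2 using 1
  abel

/-- Integrate the pointwise shrinkage loss and bound the mixed fourth moment by `d * M`. Stating the
bound through `β * τ ^ 2` avoids dividing by `τ`, which may vanish. -/
theorem norm_secondMoment_sub_shrink_le (hτ : 0 ≤ τ)
    (hi : ∀ u : EuclideanSpace ℝ (Fin d), ‖u‖ = 1 → Integrable (fun x => ⟪x, u⟫ ^ 4) ν)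
    (hM : ∀ u : EuclideanSpace ℝ (Fin d), ‖u‖ = 1 → ∫ x, ⟪x, u⟫ ^ 4 ∂ν ≤ M)
    {β : ℝ} (hβ0 : 0 ≤ β) (hβ : d * M ≤ β * τ ^ 2) (hτ0 : τ = 0 → M = 0) :
    ‖∫ x, vecMulVec (shrink τ x).ofLp (shrink τ x).ofLp ∂ν - secondMoment ν‖ ≤ β := by
  have he (j : Fin d) : ‖EuclideanSpace.single j (1 : ℝ)‖ = 1 := by simp
  have ix : Integrable (fun x : EuclideanSpace ℝ (Fin d) => vecMulVec x.ofLp x.ofLp) ν := by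
    refine integrable_of_apply fun j k => ?_
    have hj := hi _ (he j)
    have hk := hi _ (he k)
    simp only [EuclideanSpace.inner_single_right, conj_trivial, one_mul] at hj hk
    refine ((integrable_const (1 : ℝ)).add (hj.add hk)).mono'
      (Measurable.aestronglyMeasurable (by simp only [vecMulVec_apply]; fun_prop))
      (.of_forall fun x => ?_)
    simp only [vecMulVec_apply, Pi.add_apply, Real.norm_eq_abs]
    rw [abs_le]
    constructor <;> nlinarith [sq_nonneg (x j - x k), sq_nonneg (x j + x k),
      sq_nonneg (x j ^ 2 - 1 / 2), sq_nonneg (x k ^ 2 - 1 / 2)]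
  have is : Integrable (fun x : EuclideanSpace ℝ (Fin d) =>
      vecMulVec (shrink τ x).ofLp (shrink τ x).ofLp) ν := by
    refine .of_bound (Measurable.aestronglyMeasurable
      (measurable_vecMulVec_self.comp (measurable_shrink τ))) (τ ^ 2) (.of_forall fun x => ?_)
    exact (norm_vecMulVec_self_le _).trans
      (pow_le_pow_left₀ (norm_nonneg _) (norm_shrink_le hτ x) 2)
  have hsm : secondMoment ν = ∫ x, vecMulVec x.ofLp x.ofLp ∂ν := by
    ext j k
    rw [Matrix.integral_apply ix]
    rfl
  have iS := is.sub ix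
  rw [hsm, ← integral_sub is ix]
  refine (isHermitian_integral iS (.of_forall fun x => (isHermitian_vecMulVec_self _).sub
    (isHermitian_vecMulVec_self _))).norm_le_of_abs_dotProduct_le hβ0 fun u hu => ?_
  rw [integral_dotProduct_mulVec iS]
  have e (x : EuclideanSpace ℝ (Fin d)) : u.ofLp ⬝ᵥ (vecMulVec (shrink τ x).ofLp (shrink τ x).ofLp
      - vecMulVec x.ofLp x.ofLp) *ᵥ u.ofLp = -(⟪x, u⟫ ^ 2 - ⟪shrink τ x, u⟫ ^ 2) := by
    rw [sub_mulVec, dotProduct_sub, dotProduct_vecMulVec_self_mulVec,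
      dotProduct_vecMulVec_self_mulVec]
    ring
  have hnn (x : EuclideanSpace ℝ (Fin d)) : 0 ≤ ⟪x, u⟫ ^ 2 - ⟪shrink τ x, u⟫ ^ 2 :=
    sub_nonneg.2 (inner_shrink_sq_le hτ x u)
  simp only [Pi.sub_apply, e]
  rw [integral_neg, abs_neg, abs_of_nonneg (integral_nonneg hnn)]
  -- If `τ = 0` then `M = 0`, so `⟪x, u⟫` vanishes almost everywhere and there is no bias.
  rcases hτ.eq_or_lt with h0 | h0
  · have hM0 := hτ0 h0.symm
    have hz : ∫ x, ⟪x, u⟫ ^ 4 ∂ν = 0 :=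
      le_antisymm (hM0 ▸ hM u hu) (integral_nonneg fun x => by positivity)
    rw [integral_eq_zero_iff_of_nonneg (fun x => by positivity) (hi u hu)] at hz
    have : (fun x : EuclideanSpace ℝ (Fin d) => ⟪x, u⟫ ^ 2 - ⟪shrink τ x, u⟫ ^ 2) =ᵐ[ν] 0 := by
      filter_upwards [hz] with x hx
      have hx' : ⟪x, u⟫ = 0 := pow_eq_zero_iff (four_ne_zero) |>.1 hx
      rw [shrink, real_inner_smul_left, hx']
      simp
    rw [integral_congr_ae this]
    simpa using hβ0
  · have iq := integrable_norm_sq_mul_inner_sq (μ := ν) (Y := id) aestronglyMeasurable_id hi hu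
    have hq := integral_norm_sq_mul_inner_sq_le (μ := ν) (Y := id) aestronglyMeasurable_id hi hM u
    simp only [id] at iq hq
    rw [hu, one_pow, mul_one] at hq
    have h1 := integral_mono_of_nonneg (.of_forall hnn) (iq.const_mul (τ ^ 2)⁻¹)
      (.of_forall fun x => inner_sq_sub_inner_shrink_sq_le h0 x u)
    rw [integral_const_mul] at h1
    refine h1.trans ?_
    rw [inv_mul_le_iff₀ (by positivity)]
    linarith

end QuantizedMoments

/-! ### Deviation bound with free parameters. -/

section Estimator
open Matrix
open scoped Matrix.Norms.L2Operator

theorem hasLaw_prodMk_pi {n : ℕ} {E : Type*} [MeasurableSpace E] {Ω : Type*} [MeasurableSpace Ω]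
    {P : Measure Ω} {ν D : Measure E} [IsProbabilityMeasure ν] [IsProbabilityMeasure D]
    {X L : Fin n → Ω → E} (hX : ∀ i, HasLaw (X i) ν P) (hL : ∀ i, HasLaw (L i) D P)
    (hind : iIndepFun (Sum.elim X L) P) :
    HasLaw (fun ω i => (X i ω, L i ω)) (Measure.pi fun _ : Fin n => ν.prod D) P := by
  let μ : Fin n ⊕ Fin n → Measure E := Sum.elim (fun _ => ν) (fun _ => D)
  have : ∀ k, IsProbabilityMeasure (μ k) := by
    rintro (i | i) <;> simp only [μ, Sum.elim_inl, Sum.elim_inr] <;> infer_instance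
  have h1 : HasLaw (fun ω k => Sum.elim X L k ω) (Measure.pi μ) P :=
    hind.hasLaw_pi (by rintro (i | i); exacts [hX i, hL i])
  have h2 := (measurePreserving_sumPiEquivProdPi μ).hasLaw.comp h1
  have h3 := ((measurePreserving_arrowProdEquivProdArrow E E (Fin n)
    (fun _ => ν) (fun _ => D)).symm _).hasLaw.comp h2
  exact h3

variable {d n : ℕ} {τ η M : ℝ} {ν : Measure (EuclideanSpace ℝ (Fin d))}
  {Ω : Type*} [MeasurableSpace Ω] {P : Measure Ω} [IsProbabilityMeasure P]
  {X L : Fin n → Ω → EuclideanSpace ℝ (Fin d)}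

/-- Bernstein is applied to the outer products centred and scaled by `θ` to norm at most one;
undoing the scaling turns the level `t` into `t / (n * θ)`, and `β` is the bias. -/
theorem le_measureReal_opNorm_covEstimator_sub_le [IsProbabilityMeasure ν]
    (hd : 0 < d) (hn : 0 < n) (hη : 0 < η) (hτ : 0 ≤ τ)
    (hX : ∀ i, HasLaw (X i) ν P) (hL : ∀ i, HasLaw (L i) (ditherLaw d η) P)
    (hind : iIndepFun (Sum.elim X L) P)
    (hi : ∀ u : EuclideanSpace ℝ (Fin d), ‖u‖ = 1 → Integrable (fun x => ⟪x, u⟫ ^ 4) ν)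
    (hM : ∀ u : EuclideanSpace ℝ (Fin d), ‖u‖ = 1 → ∫ x, ⟪x, u⟫ ^ 4 ∂ν ≤ M) (hM0 : 0 ≤ M)
    {β : ℝ} (hβ0 : 0 ≤ β) (hβ : d * M ≤ β * τ ^ 2) (hτ0 : τ = 0 → M = 0)
    {θ : ℝ} (hθ : 0 < θ) (hθB : θ * (2 * (2 * τ ^ 2 + 9 / 2 * d * η ^ 2)) ≤ 1) (t : ℝ) :
    1 - 2 * d * Real.exp (n * (θ ^ 2 * (d * (8 * (M + 486 * η ^ 4)))) - t)
      ≤ P.real {ω | opNorm (covEstimator τ η (fun i => X i ω) (fun i => L i ω) - secondMoment ν)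
        ≤ t / (n * θ) + β} := by
  have := isProbabilityMeasure_ditherLaw d hη
  have : Nonempty (Fin d) := ⟨⟨0, hd⟩⟩
  have hn' : (0 : ℝ) < n := by exact_mod_cast hn
  let Z (i : Fin n) (ω : Ω) := (X i ω, L i ω)
  have hpi := hasLaw_prodMk_pi hX hL hind
  have hZ (i : Fin n) : HasLaw (Z i) (ν.prod (ditherLaw d η)) P :=
    (measurePreserving_eval (fun _ : Fin n => ν.prod (ditherLaw d η)) i).hasLaw.comp hpi
  have hZind : iIndepFun Z P := (iIndepFun_iff_hasLaw_pi_pi hZ).2 hpi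
  let W (p : EuclideanSpace ℝ (Fin d) × EuclideanSpace ℝ (Fin d)) : Matrix (Fin d) (Fin d) ℝ :=
    vecMulVec (quantizedSample τ η p.1 p.2).ofLp (quantizedSample τ η p.1 p.2).ofLp
  have hWm : Measurable W := measurable_vecMulVec_self.comp (measurable_quantizedSample τ η)
  have iW : Integrable W (ν.prod (ditherLaw d η)) :=
    integrable_of_apply fun j k => integrable_quantizedSample_mul hη hτ j k
  set m : Matrix (Fin d) (Fin d) ℝ := ∫ p, W p ∂ν.prod (ditherLaw d η) with hm
  let G (p : EuclideanSpace ℝ (Fin d) × EuclideanSpace ℝ (Fin d)) : Matrix (Fin d) (Fin d) ℝ :=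
    θ • (W p - m)
  have hGm : Measurable G :=
    ((continuous_const_smul θ).measurable).comp ((continuous_sub_right m).measurable.comp hWm)
  have hmH : m.IsHermitian :=
    isHermitian_integral iW (.of_forall fun p => isHermitian_vecMulVec_self _)
  have hGH (p) : (G p).IsHermitian :=
    ((isHermitian_vecMulVec_self _).sub hmH).smul (.all _)
  have hGb : ∀ᵐ p ∂ν.prod (ditherLaw d η), ‖G p‖ ≤ 1 := by
    filter_upwards [ae_norm_quantizedSample_sq_le (τ := τ) (ν := ν) hη hτ] with p hp
    rw [norm_smul, Real.norm_of_nonneg hθ.le]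
    refine le_trans ?_ hθB
    gcongr
    have h1 : ‖W p‖ ≤ _ := (norm_vecMulVec_self_le _).trans hp
    have h2 : ‖m‖ ≤ _ := norm_integral_vecMulVec_quantizedSample_le (ν := ν) hη hτ
    linarith [norm_sub_le (W p) m]
  have hG0 : ∫ p, G p ∂ν.prod (ditherLaw d η) = 0 := by
    simp only [G]
    rw [integral_smul, integral_sub iW (integrable_const _), ← hm]
    simp
  have hGv : ((θ ^ 2 * (d * (8 * (M + 486 * η ^ 4)))) • (1 : Matrix (Fin d) (Fin d) ℝ)
      - ∫ p, G p * G p ∂ν.prod (ditherLaw d η)).PosSemidef := by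
    have h := (posSemidef_sub_integral_centered_sq hη hτ hi hM hm).smul (sq_nonneg θ)
    have h2 (p) : G p * G p = θ ^ 2 • ((W p - m) * (W p - m)) := by
      simp only [G, smul_mul_smul_comm, pow_two]
    simp only [h2]
    rw [integral_smul, mul_smul, ← smul_sub]
    exact h
  have hb := measureReal_lt_norm_sum_le (P := P) (S := fun i ω => G (Z i ω))
    (v := θ ^ 2 * (d * (8 * (M + 486 * η ^ 4)))) (hZind.comp (fun _ => G) fun _ => hGm)
    (fun i => hGm.comp_aemeasurable (hZ i).aemeasurable) (fun i => .of_forall fun ω => hGH _)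
    (fun i => ae_of_ae_map (hZ i).aemeasurable (by rw [(hZ i).map_eq]; exact hGb))
    (fun i => ((hZ i).integral_comp hGm.aestronglyMeasurable).trans hG0)
    (fun i => by
      have h := (hZ i).integral_comp (f := fun p => G p * G p)
        (hGm.aestronglyMeasurable.mul hGm.aestronglyMeasurable)
      simp only [Function.comp_def] at h
      rw [h]
      exact hGv) (by positivity) t
  rw [Fintype.card_fin, Fintype.card_fin] at hb
  have hunion : P.real Set.univ ≤ P.real ({ω | t < ‖∑ i, G (Z i ω)‖} ∪
      {ω | opNorm (covEstimator τ η (fun i => X i ω) (fun i => L i ω) - secondMoment ν)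
        ≤ t / (n * θ) + β}) := by
    refine measureReal_mono fun ω _ => ?_
    rcases lt_or_ge t ‖∑ i, G (Z i ω)‖ with h | h
    · exact Or.inl h
    right
    -- The correction `η² / 4 · I` cancels the variance of the quantization error in the mean `m`.
    have hdec : covEstimator τ η (fun i => X i ω) (fun i => L i ω) - secondMoment ν
        = (n * θ)⁻¹ • ∑ i, G (Z i ω)
          + (∫ x, vecMulVec (shrink τ x).ofLp (shrink τ x).ofLp ∂ν - secondMoment ν) := by
      have hmean : m = _ := integral_vecMulVec_quantizedSample (ν := ν) hη hτ
      have hsum : (n * θ)⁻¹ • ∑ i, G (Z i ω) = (1 / (n : ℝ)) • ∑ i, W (Z i ω) - m := by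
        simp only [G]
        rw [← Finset.smul_sum, smul_smul, Finset.sum_sub_distrib, smul_sub, Finset.sum_const,
          Finset.card_univ, Fintype.card_fin, ← Nat.cast_smul_eq_nsmul ℝ, smul_smul]
        have e1 : (n * θ)⁻¹ * θ = 1 / (n : ℝ) := by field_simp
        have e2 : 1 / (n : ℝ) * n = 1 := by field_simp
        rw [e1, e2, one_smul]
      rw [hsum, hmean, covEstimator]
      simp only [W, Z]
      abel
    change ‖_‖ ≤ _
    rw [hdec]
    refine (norm_add_le _ _).trans (add_le_add ?_
      (norm_secondMoment_sub_shrink_le hτ hi hM hβ0 hβ hτ0))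
    rw [norm_smul, norm_inv, Real.norm_of_nonneg (by positivity), inv_mul_eq_div]
    gcongr
  have h2 := hunion.trans (measureReal_union_le _ _)
  rw [probReal_univ] at h2
  linarith

end Estimator

/-! ### Choice of the constants. -/

theorem lemma1 (a b c₀ : ℝ) (ha : 0 < a) (hab : a ≤ b) (hc₀ : 0 < c₀) :
    ∃ C : ℝ, 0 < C ∧
      ∀ (d n : ℕ), 2 ≤ d → c₀ * ((d : ℝ) * Real.log d) ≤ n →
      ∀ (M η τ : ℝ), 0 < η →
        a * ((n : ℝ) * d * M / Real.log d) ^ (1 / 4 : ℝ) ≤ τ →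
        τ ≤ b * ((n : ℝ) * d * M / Real.log d) ^ (1 / 4 : ℝ) →
      ∀ (Ω : Type*) [MeasurableSpace Ω] (P : Measure Ω) [IsProbabilityMeasure P]
        (ν : Measure (EuclideanSpace ℝ (Fin d)))
        (X L : Fin n → Ω → EuclideanSpace ℝ (Fin d)),
        (∀ i, HasLaw (X i) ν P) →
        (∀ i, HasLaw (L i) (ditherLaw d η) P) →
        iIndepFun (Sum.elim X L) P →
        ∫ x, x ∂ν = 0 →
        (∀ u : EuclideanSpace ℝ (Fin d), ‖u‖ = 1 →
          Integrable (fun x => ⟪x, u⟫ ^ 4) ν ∧ ∫ x, ⟪x, u⟫ ^ 4 ∂ν ≤ M) →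
      ∀ δ : ℝ, 2 < δ →
        1 - 2 * ((d : ℝ) ^ (1 - δ) + (d : ℝ) ^ (2 - δ)) ≤
          P.real {ω | opNorm (covEstimator τ η (fun i => X i ω) (fun i => L i ω) - secondMoment ν)
            ≤ C * δ * (M ^ (1 / 2 : ℝ) + η ^ 2) * √((d : ℝ) * Real.log d / n)} := by
  have hsc : 0 < √c₀ := Real.sqrt_pos.2 hc₀
  have hb : 0 < b := ha.trans_le hab
  -- Chosen so that `θ * τ ^ 2 ≤ κ * b ^ 2` and `θ * d * η ^ 2 ≤ κ / √c₀` make the scaled summands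
  -- at most one in norm; the extra `1` ensures `κ ≤ 1`.
  set κ : ℝ := 1 / (4 * b ^ 2 + 9 / √c₀ + 1) with hκ
  have hκ0 : 0 < κ := by positivity
  have hκ1 : κ ≤ 1 := by
    rw [hκ, div_le_one (by positivity)]
    have : 0 ≤ 4 * b ^ 2 + 9 / √c₀ := by positivity
    linarith
  have hκeq : κ * (4 * b ^ 2 + 9 / √c₀) ≤ 1 := by
    rw [hκ, one_div, inv_mul_le_iff₀ (by positivity)]
    linarith
  -- The two summands pay for fluctuation and bias. `3888 = 8 * 486` comes from the variance, and
  -- one more unit leaves the exponent `-δ * log d`.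
  refine ⟨3889 / κ + 1 / a ^ 2, by positivity, ?_⟩
  intro d n hd hn M η τ hη hτ1 hτ2 Ω _ P _ ν X L hX hL hind _ hmom δ hδ
  have hd0 : (0 : ℝ) < d := by exact_mod_cast (by lia : 0 < d)
  have hℓ : 0 < Real.log d := Real.log_pos (by exact_mod_cast (by lia : 1 < d))
  have hn0 : (0 : ℝ) < n := lt_of_lt_of_le (by positivity) hn
  have hnN : 0 < n := by exact_mod_cast hn0
  set ℓ := Real.log d with hℓd
  have : IsProbabilityMeasure ν :=
    (hX ⟨0, hnN⟩).isProbabilityMeasure_iff.1 inferInstance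
  have hM0 : 0 ≤ M := by
    have h := (hmom (EuclideanSpace.single ⟨0, by lia⟩ (1 : ℝ)) (by simp)).2
    exact (integral_nonneg fun x => by positivity).trans h
  rw [← Real.sqrt_eq_rpow]
  set w := √(d * ℓ / n) with hw
  have hw0 : 0 < w := Real.sqrt_pos.2 (by positivity)
  have hw2 : n * w ^ 2 = d * ℓ := by
    rw [hw, Real.sq_sqrt (by positivity)]; field_simp
  have hwc : w ≤ 1 / √c₀ := by
    rw [le_div_iff₀ hsc, ← sq_le_sq₀ (by positivity) zero_le_one, mul_pow, Real.sq_sqrt hc₀.le]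
    have h : c₀ * (n * w ^ 2) ≤ n := by rw [hw2]; exact hn
    rw [one_pow]
    exact le_of_mul_le_mul_left (by linarith : n * (w ^ 2 * c₀) ≤ n * 1) hn0
  set s := √M with hs
  have hs0 : 0 ≤ s := Real.sqrt_nonneg _
  have hs2 : s ^ 2 = M := Real.sq_sqrt hM0
  set r := ((n : ℝ) * d * M / ℓ) ^ (1 / 4 : ℝ) with hr
  have hr0 : 0 ≤ r := by positivity
  have hr4 : r ^ 4 = n * d * M / ℓ := by
    rw [hr, ← Real.rpow_natCast, ← Real.rpow_mul (by positivity)]; norm_num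
  -- The balance behind the choice of `τ`: up to constants, `d * M / τ ^ 2` equals `√M * w`.
  have hr2 : r ^ 2 * w = s * d := by
    rw [← sq_eq_sq₀ (by positivity) (by positivity)]
    have h1 : n * (r ^ 4 * w ^ 2) = n * (s * d) ^ 2 := by
      rw [mul_left_comm, hw2, hr4, mul_pow, hs2]; field_simp
    have h2 := mul_left_cancel₀ hn0.ne' h1
    rw [← h2]; ring
  have hτ0 : 0 ≤ τ := le_trans (by positivity) hτ1
  have hτa : a ^ 2 * r ^ 2 ≤ τ ^ 2 := by
    rw [← mul_pow]; exact pow_le_pow_left₀ (by positivity) hτ1 2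
  have hτb : τ ^ 2 ≤ b ^ 2 * r ^ 2 := by
    rw [← mul_pow]; exact pow_le_pow_left₀ hτ0 hτ2 2
  set A := s + η ^ 2 with hA
  have hη2 : 0 < η ^ 2 := by positivity
  have hA0 : 0 < A := by positivity
  set θ := κ * w / (A * d) with hθ
  have hθ0 : 0 < θ := by positivity
  have hθA : θ * A * d = κ * w := by rw [hθ]; field_simp
  have hθτ : θ * τ ^ 2 ≤ κ * b ^ 2 := by
    have h1 : θ * r ^ 2 * A ≤ κ * A := by
      have : θ * r ^ 2 * A * d = κ * s * d := by
        linear_combination r ^ 2 * hθA + κ * hr2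
      have h2 : θ * r ^ 2 * A = κ * s := mul_right_cancel₀ hd0.ne' this
      rw [h2]
      gcongr
      linarith
    have h2 : θ * r ^ 2 ≤ κ := le_of_mul_le_mul_right h1 hA0
    calc θ * τ ^ 2 ≤ θ * (b ^ 2 * r ^ 2) := by gcongr
      _ = θ * r ^ 2 * b ^ 2 := by ring
      _ ≤ κ * b ^ 2 := by gcongr
  have hθη : θ * d * η ^ 2 ≤ κ * (1 / √c₀) := by
    calc θ * d * η ^ 2 ≤ θ * d * A := by gcongr; linarith
      _ = κ * w := by rw [← hθA]; ring
      _ ≤ κ * (1 / √c₀) := by gcongr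
  have hB : θ * (2 * (2 * τ ^ 2 + 9 / 2 * d * η ^ 2)) ≤ 1 := by
    refine le_trans ?_ hκeq
    have e : κ * (4 * b ^ 2 + 9 / √c₀) = 4 * (κ * b ^ 2) + 9 * (κ * (1 / √c₀)) := by ring
    rw [e]
    linarith
  have hθAw : n * θ * A * w = κ * ℓ := by
    refine mul_right_cancel₀ hd0.ne' ?_
    linear_combination n * w * hθA + κ * hw2
  have hvar : n * (θ ^ 2 * (d * (8 * (M + 486 * η ^ 4)))) ≤ 3888 * κ ^ 2 * ℓ := by
    have h1 : n * d * (θ * A) ^ 2 = κ ^ 2 * ℓ := by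
      refine mul_right_cancel₀ hd0.ne' ?_
      linear_combination n * (θ * A * d + κ * w) * hθA + κ ^ 2 * hw2
    have h2 : M + 486 * η ^ 4 ≤ 486 * A ^ 2 := by
      rw [← hs2, hA]
      nlinarith only [mul_nonneg hs0 hη2.le, sq_nonneg s]
    calc n * (θ ^ 2 * (d * (8 * (M + 486 * η ^ 4))))
        ≤ n * (θ ^ 2 * (d * (8 * (486 * A ^ 2)))) := by gcongr
      _ = 3888 * (n * d * (θ * A) ^ 2) := by ring
      _ = 3888 * κ ^ 2 * ℓ := by rw [h1]; ring
  have hβ : d * M ≤ A * w / a ^ 2 * τ ^ 2 := by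
    calc d * M = s * (s * d) := by rw [← hs2]; ring
      _ = s * w / a ^ 2 * (a ^ 2 * r ^ 2) := by rw [← hr2]; field_simp
      _ ≤ A * w / a ^ 2 * τ ^ 2 := by gcongr; linarith
  have hτM : τ = 0 → M = 0 := by
    intro h
    rw [h] at hτa
    have hr : r ^ 2 = 0 := by
      have h2 : 0 < a ^ 2 := by positivity
      rw [zero_pow two_ne_zero] at hτa
      exact le_antisymm (nonpos_of_mul_nonpos_right hτa h2) (sq_nonneg r)
    rw [hr, zero_mul] at hr2
    have : s = 0 := (mul_eq_zero.1 hr2.symm).resolve_right hd0.ne'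
    rw [← hs2, this]; ring
  have hmain := le_measureReal_opNorm_covEstimator_sub_le (by lia) hnN hη hτ0 hX hL hind
    (fun u hu => (hmom u hu).1) (fun u hu => (hmom u hu).2) hM0 (by positivity) hβ hτM hθ0 hB
    (3889 * δ * ℓ)
  -- Bernstein gives failure probability at most `2 * d ^ (1 - δ)`; the term `d ^ (2 - δ)` is slack.
  have hexp : 2 * d * Real.exp (n * (θ ^ 2 * (d * (8 * (M + 486 * η ^ 4)))) - 3889 * δ * ℓ)
      ≤ 2 * ((d : ℝ) ^ (1 - δ) + (d : ℝ) ^ (2 - δ)) := by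
    have h1 : n * (θ ^ 2 * (d * (8 * (M + 486 * η ^ 4)))) - 3889 * δ * ℓ ≤ ℓ * -δ := by
      have h : κ ^ 2 ≤ δ := (pow_le_one₀ hκ0.le hκ1).trans (by linarith)
      have h' := mul_le_mul_of_nonneg_right h hℓ.le
      linarith only [hvar, h']
    have h2 : (d : ℝ) ^ (1 - δ) = d * Real.exp (ℓ * -δ) := by
      rw [sub_eq_add_neg, Real.rpow_add hd0, Real.rpow_one, Real.rpow_def_of_pos hd0 (-δ)]
    have h3 : 0 ≤ (d : ℝ) ^ (2 - δ) := by positivity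
    have h4 := mul_le_mul_of_nonneg_left (Real.exp_le_exp.2 h1) hd0.le
    rw [← h2] at h4
    linarith only [h3, h4]
  refine (sub_le_sub_left hexp 1).trans (hmain.trans (measureReal_mono fun ω hω => ?_))
  rw [Set.mem_ofPred_eq] at hω ⊢
  refine hω.trans ?_
  have ht : 3889 * δ * ℓ / (n * θ) = 3889 / κ * δ * A * w := by
    rw [div_eq_iff (by positivity)]
    have : 3889 / κ * δ * A * w * (n * θ) = 3889 / κ * δ * (n * θ * A * w) := by ring
    rw [this, hθAw]
    field_simp
  rw [ht]
  -- The bias carries no factor `δ`; one is inserted using `1 ≤ δ`.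
  have h5 : A * w / a ^ 2 ≤ 1 / a ^ 2 * δ * A * w := by
    have : A * w / a ^ 2 = 1 / a ^ 2 * 1 * A * w := by ring
    rw [this]
    gcongr
    linarith only [hδ]
  linarith only [h5]
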